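/- Let $H\in(0,1)$, let $B^H=(B^H_t)_{t\in\mathbb R}$ be a two-sided fractional Brownian motion with Hurst parameter $H$ on a probability space $(\Omega,\mathcal F,\mathbb P)$ (a centred continuous Gaussian process with $\mathbb E[B^H_sB^H_t]=\frac12(|s|^{2H}+|t|^{2H}-|t-s|^{2H})$). For $\varepsilon>0$ let $$y^\varepsilon_t=\frac{\sigma}{\varepsilon^{H}}\int_{-\infty}^t e^{-(t-s)/\varepsilon}\,dB^H_s,\qquad t\in\mathbb R,$$ (an improper pathwise Riemann–Stieltjes integral) be the stationary rescaled fractional Ornstein–Uhlenbeck process, where the number $\sigma$ is chosen such that $y^1_0$ has the standard normal distribution $N(0,1)$. Put $X^\varepsilon_t=\varepsilon^{H-1}\int_0^t y^\varepsilon_s\,ds$, and write $x_{s,t}=x_t-x_s$. For $\theta:[0,t]\to\mathbb R$ let $|\theta|_{\mathcal C^{\gamma'}([0,t])}=\sup_{u\ne v\in[0,t]}|\theta_u-\theta_v|/|u-v|^{\gamma'}$ be the Hölder seminorm. Fix $p\in(1,\infty)$ and $T\in(0,\infty)$. 1. There is a constant $C$ such that for all $\varepsilon>0$ $$\sup_{s,t\in[0,T]}\big\|X^\varepsilon_{s,t}-\sigma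 B^H_{s,t}\big\|_{L^p}\le C\,\varepsilon^{H}.$$ 2. Let $0\le\gamma'<\gamma<H$. There is a constant $C$ such that for all $\varepsilon>0$ and all $t\in[0,T]$ $$\Big\|\,\big|X^\varepsilon-\sigma B^H\big|_{\mathcal C^{\gamma'}([0,t])}\Big\|_{L^p}\le C\,t^{\gamma-\gamma'}\,\varepsilon^{H-\gamma}.$$ Consequently, for every $t_0\in(0,T]$ there is a constant $C$, depending on $t_0$, such that for all $\varepsilon>0$ and all $t\in[t_0,T]$ $$\Big\|\,\big|X^\varepsilon-\sigma B^H\big|_{\mathcal C^{\gamma'}([0,t])}\Big\|_{L^p}\le C\,t^{\gamma}\,\varepsilon^{H-\gamma}.$$ -/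

import Mathlib

open MeasureTheory ProbabilityTheory Filter Topology
open scoped NNReal ENNReal

noncomputable section

namespace FOU

/-- `B` is a two-sided fractional Brownian motion with Hurst parameter `H` under `P`: a centred
Gaussian process indexed by `ℝ` with almost surely continuous paths and covariance
`(|s|^(2H) + |t|^(2H) - |t - s|^(2H)) / 2`. In particular `B 0 = 0` almost surely and
`E (B 1)^2 = 1`. -/
structure IsTwoSidedFBM {Ω : Type*} [MeasurableSpace Ω] (H : ℝ) (B : ℝ → Ω → ℝ)
    (P : Measure Ω) : Prop where
  gaussian : IsGaussianProcess B P
  centred : ∀ t, ∫ ω, B t ω ∂P = 0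
  cov : ∀ s t, covariance (B s) (B t) P =
    (|s| ^ (2 * H) + |t| ^ (2 * H) - |t - s| ^ (2 * H)) / 2
  cont : ∀ᵐ ω ∂P, Continuous fun t => B t ω

/-- `I` is the Riemann-Stieltjes integral of `f` against `g` on `[a, b]` (for `a ≤ b`): the tagged
sums `∑ f(τᵢ) (g(sᵢ₊₁) - g(sᵢ))` over partitions `a = s₀ ≤ s₁ ≤ ⋯ ≤ sₙ = b` with tags
`τᵢ ∈ [sᵢ, sᵢ₊₁]` converge to `I` as the mesh tends to zero. -/
def HasRSIntegral (f g : ℝ → ℝ) (a b I : ℝ) : Prop :=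
  ∀ η > 0, ∃ δ > 0, ∀ (n : ℕ) (s τ : ℕ → ℝ), s 0 = a → s n = b →
    (∀ i < n, s i ≤ τ i ∧ τ i ≤ s (i + 1) ∧ s (i + 1) - s i < δ) →
    |∑ i ∈ Finset.range n, f (τ i) * (g (s (i + 1)) - g (s i)) - I| < η

/-- `I` is the improper Riemann-Stieltjes integral of `f` against `g` on `(-∞, t]`. -/
def HasImproperRSIntegral (f g : ℝ → ℝ) (t I : ℝ) : Prop :=
  ∃ J : ℝ → ℝ, (∀ a ≤ t, HasRSIntegral f g a t (J a)) ∧ Tendsto J atBot (𝓝 I)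

open Classical in
/-- The improper Riemann-Stieltjes integral of `f` against `g` on `(-∞, t]`
(with value `0` where it does not exist). -/
def improperRSIntegral (f g : ℝ → ℝ) (t : ℝ) : ℝ :=
  if h : ∃ I, HasImproperRSIntegral f g t I then h.choose else 0

/-- The stationary rescaled fractional Ornstein-Uhlenbeck process
`y^ε_t = σ ε^(-H) ∫_{-∞}^t e^{-(t-s)/ε} dB_s`. -/
def fOU {Ω : Type*} (H σ : ℝ) (B : ℝ → Ω → ℝ) (ε t : ℝ) (ω : Ω) : ℝ :=
  σ / ε ^ H * improperRSIntegral (fun s => Real.exp (-(t - s) / ε)) (fun s => B s ω) t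

/-- `X^ε_t = ε^(H-1) ∫_0^t y^ε_s ds`. -/
def slowProcess {Ω : Type*} (H σ : ℝ) (B : ℝ → Ω → ℝ) (ε t : ℝ) (ω : Ω) : ℝ :=
  ε ^ (H - 1) * ∫ s in (0 : ℝ)..t, fOU H σ B ε s ω

/-- The path-wise error `X^ε_t - σ B_t`. -/
def errorProcess {Ω : Type*} (H σ : ℝ) (B : ℝ → Ω → ℝ) (ε t : ℝ) (ω : Ω) : ℝ :=
  slowProcess H σ B ε t ω - σ * B t ω

/-- The `r`-Hölder seminorm of `θ` on the interval `[0, t]`, with values in `[0, ∞]`. -/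
def holderSeminorm (r : ℝ≥0) (t : ℝ) (θ : ℝ → ℝ) : ℝ≥0∞ :=
  eHolderNorm r (fun u : Set.Icc (0 : ℝ) t => θ u)

end FOU

end

/-!
The fractional Ornstein-Uhlenbeck process solves the Langevin equation
`dy = -y / ε dt + σ ε^(-H) dB`. Integrating it over `[s, t]` and multiplying by `ε^(H-1)` gives
`X_t - X_s - σ (B_t - B_s) = -ε^H (y_t - y_s)`, so the error is, up to a constant, `-σ Y` with
`y = σ ε^(-H) Y`. Integration by parts turns the improper Riemann-Stieltjes integral into
`Y_t = ∫ (B_t - B_{t-u}) μ(du)`, with `μ` the exponential law of rate `1 / ε`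
(`improperRSIntegral_exp_eq_expMean`, `continuous_expMean_and_integral`).

Since `B_t - B_s` is a centred Gaussian of variance `|t - s|^(2H)`, Jensen's inequality for this
mixture bounds the `L^q` norm of `Y_t` by a multiple of `ε^H`, because `∫ u^(Hq) μ(du)` is
`Γ(Hq + 1) ε^(Hq)`, and that of `Y_t - Y_s` by a multiple of `|t - s|^H`. The increments of the
error are therefore `O(min(ε, |t - s|)^H)` in every `L^q`
(`IsTwoSidedFBM.exists_eLpNorm_errorProcess_sub_le`). The first bound is the first claim.
As `min(ε, |t - s|)^H ≤ ε^(H-γ) |t - s|^γ`, the second claim follows from a quantitative form of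
Kolmogorov's continuity theorem (`exists_eLpNorm_holderSeminorm_le`), applied with an exponent `q`
so large that `γ' + 1 / q < γ`, and from the inclusion of `L^q` in `L^p`.

The continuity theorem, applied to `B_{-u}` on `[0, n]` for every `n`, also shows that almost every
path grows subexponentially at `-∞` (`IsTwoSidedFBM.ae_exists_le_exp`). This is what makes the
improper integral exist, for all times `t` at once.
-/

noncomputable section
namespace FOU

/-! ### Riemann-Stieltjes integrals of smooth functions -/

/-- Integration by parts for the Riemann-Stieltjes integral of a `C¹` function against a continuous
one. -/
lemma hasRSIntegral_of_hasDerivAt {f f' g : ℝ → ℝ} {a b : ℝ} (hab : a ≤ b)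
    (hf : ∀ x, HasDerivAt f (f' x) x) (hf' : Continuous f') (hg : Continuous g) :
    HasRSIntegral f g a b (f b * g b - f a * g a - ∫ x in a..b, f' x * g x) := by
  intro η hη
  obtain ⟨M, hM⟩ := isCompact_Icc.exists_bound_of_continuousOn (s := Set.Icc a b) hf'.continuousOn
  have hM0 : 0 ≤ M := (norm_nonneg _).trans (hM a ⟨le_rfl, hab⟩)
  have hκ : 0 < η / (M * (b - a) + 1) := by
    have : 0 ≤ M * (b - a) := mul_nonneg hM0 (by linarith)
    positivity
  set κ := η / (M * (b - a) + 1) with hκdef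
  obtain ⟨δ, hδ, hδ'⟩ := Metric.uniformContinuousOn_iff.1
    (isCompact_Icc.uniformContinuousOn_of_continuous (s := Set.Icc a b) hg.continuousOn) κ hκ
  refine ⟨δ, hδ, fun n s τ hs0 hsn hs => ?_⟩
  have hmono : ∀ i j, i ≤ j → j ≤ n → s i ≤ s j := by
    intro i j hij
    induction j, hij using Nat.le_induction with
    | base => simp
    | succ j hij ih =>
      intro hj
      have := hs j (by omega)
      linarith [ih (by omega)]
  have hmem : ∀ i ≤ n, s i ∈ Set.Icc a b := fun i hi =>
    ⟨hs0 ▸ hmono 0 i (Nat.zero_le _) hi, hsn ▸ hmono i n hi le_rfl⟩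
  have hint' : ∀ (x y : ℝ), IntervalIntegrable (fun z => f' z * g z) volume x y :=
    fun x y => (hf'.mul hg).intervalIntegrable _ _
  have hftc : ∀ x y, ∫ z in x..y, f' z = f y - f x := fun x y =>
    intervalIntegral.integral_eq_sub_of_hasDerivAt (fun z _ => hf z)
      (hf'.intervalIntegrable _ _)
  have hsplit : ∀ c x y, ∫ z in x..y, f' z * (g z - c) =
      (∫ z in x..y, f' z * g z) - (f y - f x) * c := by
    intro c x y
    simp_rw [mul_sub]
    have hc : IntervalIntegrable (fun z => f' z * c) volume x y :=
      (hf'.mul continuous_const).intervalIntegrable _ _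
    rw [intervalIntegral.integral_sub (hint' x y) hc, intervalIntegral.integral_mul_const, hftc]
  have key : ∀ i < n, |f (τ i) * (g (s (i + 1)) - g (s i))
      - (f (s (i + 1)) * g (s (i + 1)) - f (s i) * g (s i)
        - ∫ x in s i..s (i + 1), f' x * g x)| ≤ M * κ * (s (i + 1) - s i) := by
    intro i hi
    obtain ⟨h1, h2, h3⟩ := hs i hi
    have e1 := hmem i hi.le
    have e2 := hmem (i + 1) hi
    -- compare `g` with its value at the nearer end of the subinterval cut at the tag
    have : f (τ i) * (g (s (i + 1)) - g (s i))
      - (f (s (i + 1)) * g (s (i + 1)) - f (s i) * g (s i)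
        - ∫ x in s i..s (i + 1), f' x * g x) =
      (∫ z in s i..τ i, f' z * (g z - g (s i)))
        + ∫ z in τ i..s (i + 1), f' z * (g z - g (s (i + 1))) := by
      rw [hsplit, hsplit, ← intervalIntegral.integral_add_adjacent_intervals
        (hint' (s i) (τ i)) (hint' (τ i) (s (i + 1)))]
      ring
    rw [this]
    have b1 : ‖∫ z in s i..τ i, f' z * (g z - g (s i))‖ ≤ M * κ * |τ i - s i| := by
      refine intervalIntegral.norm_integral_le_of_norm_le_const fun z hz => ?_
      rw [Set.uIoc_of_le h1] at hz
      rw [norm_mul]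
      refine mul_le_mul (hM z ⟨e1.1.trans hz.1.le, by linarith [hz.2, e2.2]⟩) ?_
        (norm_nonneg _) hM0
      refine (hδ' z ⟨e1.1.trans hz.1.le, by linarith [hz.2, e2.2]⟩ _ e1 ?_).le
      rw [Real.dist_eq, abs_of_nonneg] <;> linarith [hz.1, hz.2]
    have b2 : ‖∫ z in τ i..s (i + 1), f' z * (g z - g (s (i + 1)))‖ ≤
        M * κ * |s (i + 1) - τ i| := by
      refine intervalIntegral.norm_integral_le_of_norm_le_const fun z hz => ?_
      rw [Set.uIoc_of_le h2] at hz
      rw [norm_mul]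
      refine mul_le_mul (hM z ⟨by linarith [hz.1, e1.1], by linarith [hz.2, e2.2]⟩) ?_
        (norm_nonneg _) hM0
      refine (hδ' z ⟨by linarith [hz.1, e1.1], by linarith [hz.2, e2.2]⟩ _ e2 ?_).le
      rw [Real.dist_eq, abs_of_nonpos] <;> linarith [hz.1, hz.2]
    rw [abs_of_nonneg (by linarith)] at b1 b2
    calc _ ≤ _ := abs_add_le _ _
      _ ≤ M * κ * (τ i - s i) + M * κ * (s (i + 1) - τ i) := add_le_add b1 b2
      _ = _ := by ring
  have htel : f b * g b - f a * g a - ∫ x in a..b, f' x * g x =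
      ∑ i ∈ Finset.range n, (f (s (i + 1)) * g (s (i + 1)) - f (s i) * g (s i)
        - ∫ x in s i..s (i + 1), f' x * g x) := by
    rw [Finset.sum_sub_distrib, Finset.sum_range_sub (fun i => f (s i) * g (s i)),
      intervalIntegral.sum_integral_adjacent_intervals (fun k _ => hint' _ _), hs0, hsn]
  rw [htel, ← Finset.sum_sub_distrib]
  calc _ ≤ ∑ i ∈ Finset.range n, M * κ * (s (i + 1) - s i) :=
        (Finset.abs_sum_le_sum_abs _ _).trans
          (Finset.sum_le_sum fun i hi => key i (Finset.mem_range.1 hi))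
    _ = M * (b - a) * κ := by
        rw [← Finset.mul_sum, Finset.sum_range_sub, hs0, hsn]; ring
    _ < (M * (b - a) + 1) * κ := by linarith
    _ = η := by
        rw [hκdef]
        have : 0 ≤ M * (b - a) := mul_nonneg hM0 (by linarith)
        field_simp

lemma HasRSIntegral.unique {f g : ℝ → ℝ} {a b I J : ℝ} (hab : a ≤ b)
    (hI : HasRSIntegral f g a b I) (hJ : HasRSIntegral f g a b J) : I = J := by
  refine eq_of_forall_dist_le fun η hη => ?_
  obtain ⟨δ, hδ, h⟩ := hI (η / 2) (by linarith)
  obtain ⟨δ', hδ', h'⟩ := hJ (η / 2) (by linarith)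
  -- a uniform partition finer than both meshes
  obtain ⟨n, hn⟩ := exists_nat_gt ((b - a) / min δ δ')
  have hmin : 0 < min δ δ' := lt_min hδ hδ'
  have hn0 : (0 : ℝ) < n + 1 := by positivity
  set s : ℕ → ℝ := fun i => a + i * ((b - a) / (n + 1)) with hs
  have hstep : ∀ i, s (i + 1) - s i = (b - a) / (n + 1) := fun i => by
    simp only [hs]
    push_cast
    ring
  have hlt : (b - a) / (n + 1) < min δ δ' := by
    rw [div_lt_iff₀ hmin] at hn
    rw [div_lt_iff₀ hn0]
    nlinarith
  have hle : 0 ≤ (b - a) / (n + 1) := div_nonneg (by linarith) hn0.le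
  have h0 : s 0 = a := by simp [hs]
  have h1 : s (n + 1) = b := by simp only [hs]; push_cast; field_simp; ring
  have p1 := h (n + 1) s s h0 h1 fun i _ =>
    ⟨le_rfl, by linarith [hstep i], by linarith [hstep i, min_le_left δ δ']⟩
  have p2 := h' (n + 1) s s h0 h1 fun i _ =>
    ⟨le_rfl, by linarith [hstep i], by linarith [hstep i, min_le_right δ δ']⟩
  rw [Real.dist_eq]
  rw [abs_lt] at p1 p2
  rw [abs_le]
  constructor <;> linarith

lemma HasImproperRSIntegral.improperRSIntegral_eq {f g : ℝ → ℝ} {t I : ℝ}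
    (h : HasImproperRSIntegral f g t I) : improperRSIntegral f g t = I := by
  have hex : ∃ I, HasImproperRSIntegral f g t I := ⟨I, h⟩
  rw [improperRSIntegral, dif_pos hex]
  obtain ⟨J, hJ, hJl⟩ := h
  obtain ⟨J', hJ', hJl'⟩ := hex.choose_spec
  refine tendsto_nhds_unique hJl' (hJl.congr' ?_)
  filter_upwards [eventually_le_atBot t] with a ha using (hJ a ha).unique ha (hJ' a ha)

/-! ### Exponential averages and the Langevin equation -/

lemma exponentialPDF_sub_toReal {r : ℝ} (hr : 0 < r) (t s : ℝ) :
    (exponentialPDF r (t - s)).toReal =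
      (Set.Iic t).indicator (fun s => r * Real.exp (-(r * (t - s)))) s := by
  by_cases h : s ≤ t
  · rw [Set.indicator_of_mem (by exact h), exponentialPDF_of_nonneg (by linarith),
      ENNReal.toReal_ofReal (by positivity)]
  · rw [Set.indicator_of_notMem (by exact h), exponentialPDF_of_neg (by linarith),
      ENNReal.toReal_zero]

lemma measurable_exponentialPDF (r : ℝ) : Measurable (exponentialPDF r) :=
  (measurable_exponentialPDFReal r).ennreal_ofReal

lemma exponentialPDF_lt_top (r : ℝ) : ∀ᵐ x, exponentialPDF r x < ∞ :=
  ae_of_all _ fun _ => ENNReal.ofReal_lt_top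

lemma expMeasure_eq_withDensity (r : ℝ) :
    expMeasure r = volume.withDensity (exponentialPDF r) := rfl

lemma integral_comp_sub_left_expMeasure {r : ℝ} (hr : 0 < r) (k : ℝ → ℝ) (t : ℝ) :
    ∫ u, k (t - u) ∂expMeasure r = ∫ s in Set.Iic t, r * Real.exp (-(r * (t - s))) * k s := by
  rw [expMeasure_eq_withDensity, integral_withDensity_eq_integral_toReal_smul
    (measurable_exponentialPDF r) (exponentialPDF_lt_top r), ← integral_indicator measurableSet_Iic,
    ← integral_sub_left_eq_self _ volume t]
  refine integral_congr_ae (ae_of_all _ fun s => ?_)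
  have := exponentialPDF_sub_toReal hr t s
  simp only [sub_sub_cancel, smul_eq_mul, this, Set.indicator_apply]
  split_ifs <;> simp

lemma integrable_comp_sub_left_expMeasure {r : ℝ} (hr : 0 < r) {k : ℝ → ℝ} {t : ℝ}
    (hk : IntegrableOn (fun s => Real.exp (r * s) * k s) (Set.Iic t)) :
    Integrable (fun u => k (t - u)) (expMeasure r) := by
  rw [expMeasure_eq_withDensity, integrable_withDensity_iff_integrable_smul'
    (measurable_exponentialPDF r) (exponentialPDF_lt_top r)]
  have h2 : Integrable ((Set.Iic t).indicator (fun s => r * Real.exp (-(r * (t - s))) * k s)) := by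
    rw [integrable_indicator_iff measurableSet_Iic]
    refine (hk.const_mul (r * Real.exp (-(r * t)))).congr (ae_of_all _ fun s => ?_)
    simp only
    rw [show -(r * (t - s)) = -(r * t) + r * s by ring, Real.exp_add]
    ring
  refine (h2.comp_sub_left t).congr (ae_of_all _ fun s => ?_)
  have := exponentialPDF_sub_toReal hr t (t - s)
  rw [sub_sub_cancel] at this
  simp only [smul_eq_mul, this, Set.indicator_apply]
  split_ifs <;> simp

/-- The average of the increments `g t - g (t - u)` over an exponentially distributed lag `u` of
rate `r`. For `r = 1 / ε` it is the integral of `e^{-(t-s)/ε}` against `g` on `(-∞, t]`. -/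
def expMean (r : ℝ) (g : ℝ → ℝ) (t : ℝ) : ℝ :=
  ∫ u, (g t - g (t - u)) ∂expMeasure r

section growth

variable {r c K : ℝ} {g : ℝ → ℝ}

lemma integrableOn_Iic_exp_mul (hc : c < r) (hg : Continuous g)
    (hK : ∀ s ≤ 0, |g s| ≤ K * Real.exp (-(c * s))) (t : ℝ) :
    IntegrableOn (fun s => Real.exp (r * s) * g s) (Set.Iic t) := by
  have hcont : Continuous (fun s => Real.exp (r * s) * g s) := by fun_prop
  have h0 : IntegrableOn (fun s => Real.exp (r * s) * g s) (Set.Iic 0) := by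
    refine Integrable.mono' ((integrableOn_exp_mul_Iic (sub_pos.2 hc) 0).const_mul K)
      hcont.aestronglyMeasurable ?_
    filter_upwards [ae_restrict_mem measurableSet_Iic] with s hs
    rw [norm_mul, Real.norm_eq_abs, Real.abs_exp, Real.norm_eq_abs]
    calc _ ≤ Real.exp (r * s) * (K * Real.exp (-(c * s))) := by
          gcongr
          exact hK s hs
      _ = _ := by
          rw [show (r - c) * s = r * s + -(c * s) by ring, Real.exp_add]
          ring
  refine (h0.union (hcont.integrableOn_Icc (a := 0) (b := t))).mono_set fun s hs => ?_
  rcases le_total s 0 with h | h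
  · exact Or.inl h
  · exact Or.inr ⟨h, hs⟩

lemma tendsto_exp_mul_atBot (hc : c < r)
    (hK : ∀ s ≤ 0, |g s| ≤ K * Real.exp (-(c * s))) :
    Tendsto (fun s => Real.exp (r * s) * g s) atBot (𝓝 0) := by
  have h1 : Tendsto (fun s => K * Real.exp ((r - c) * s)) atBot (𝓝 0) := by
    have : Tendsto (fun s => (r - c) * s) atBot atBot :=
      tendsto_id.const_mul_atBot (sub_pos.2 hc)
    simpa using (Real.tendsto_exp_atBot.comp this).const_mul K
  refine squeeze_zero_norm' ?_ h1
  filter_upwards [eventually_le_atBot 0] with s hs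
  rw [norm_mul, Real.norm_eq_abs, Real.abs_exp, Real.norm_eq_abs]
  calc _ ≤ Real.exp (r * s) * (K * Real.exp (-(c * s))) := by
        gcongr
        exact hK s hs
    _ = _ := by
        rw [show (r - c) * s = r * s + -(c * s) by ring, Real.exp_add]
        ring

/-- The mean splits off `g t` because the exponential law is a probability measure; what remains is
a convolution integral over the past. -/
lemma expMean_eq (hr : 0 < r) (hc : c < r) (hg : Continuous g)
    (hK : ∀ s ≤ 0, |g s| ≤ K * Real.exp (-(c * s))) (t : ℝ) :
    expMean r g t =
      g t - r * (Real.exp (-(r * t)) * ∫ s in Set.Iic t, Real.exp (r * s) * g s) := by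
  have := isProbabilityMeasure_expMeasure hr
  rw [expMean, integral_sub (integrable_const _)
    (integrable_comp_sub_left_expMeasure hr (integrableOn_Iic_exp_mul hc hg hK t)),
    integral_comp_sub_left_expMeasure hr, integral_const, probReal_univ, one_smul,
    ← integral_const_mul, ← integral_const_mul]
  congr 2
  ext s
  rw [show -(r * (t - s)) = -(r * t) + r * s by ring, Real.exp_add]
  ring

/-- The boundary term of the integration by parts at `a → -∞` vanishes since `g` grows more slowly
than `e^{-s/ε}`. -/
lemma improperRSIntegral_exp_eq_expMean {ε : ℝ} (hε : 0 < ε) (hc : c < ε⁻¹) (hg : Continuous g)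
    (hK : ∀ s ≤ 0, |g s| ≤ K * Real.exp (-(c * s))) (t : ℝ) :
    improperRSIntegral (fun s => Real.exp (-(t - s) / ε)) g t = expMean ε⁻¹ g t := by
  have hr : 0 < ε⁻¹ := inv_pos.2 hε
  have hexp : ∀ s, Real.exp (-(t - s) / ε) = Real.exp (-(ε⁻¹ * t)) * Real.exp (ε⁻¹ * s) := by
    intro s
    rw [← Real.exp_add]
    congr 1
    field_simp
    ring
  refine HasImproperRSIntegral.improperRSIntegral_eq
    ⟨fun a => Real.exp (-(t - t) / ε) * g t - Real.exp (-(t - a) / ε) * g a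
      - ∫ s in a..t, Real.exp (-(t - s) / ε) * (1 / ε) * g s, fun a ha => ?_, ?_⟩
  · refine hasRSIntegral_of_hasDerivAt ha (fun x => ?_) (by fun_prop) hg
    have h1 : HasDerivAt (fun s : ℝ => -(t - s) / ε) (1 / ε) x := by
      have := ((hasDerivAt_id x).const_sub t).neg.div_const ε
      simpa using this
    exact h1.exp
  · have hint := integrableOn_Iic_exp_mul hc hg hK t
    have h1 := intervalIntegral_tendsto_integral_Iic t hint tendsto_id
    have h2 := tendsto_exp_mul_atBot hc hK
    rw [expMean_eq hr hc hg hK]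
    have h3 := ((h2.const_mul (Real.exp (-(ε⁻¹ * t)))).const_sub (g t)).sub
      ((h1.const_mul (Real.exp (-(ε⁻¹ * t)))).const_mul ε⁻¹)
    rw [mul_zero, sub_zero] at h3
    refine h3.congr fun a => ?_
    simp_rw [hexp]
    rw [← intervalIntegral.integral_const_mul, ← intervalIntegral.integral_const_mul,
      ← Real.exp_add, neg_add_cancel, Real.exp_zero]
    congr 1
    · ring
    · refine intervalIntegral.integral_congr fun s _ => ?_
      ring

/-- The averages solve the Langevin equation `dY = dg - r Y dt`, in integrated form. -/
lemma continuous_expMean_and_integral (hr : 0 < r) (hc : c < r) (hg : Continuous g)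
    (hK : ∀ s ≤ 0, |g s| ≤ K * Real.exp (-(c * s))) :
    Continuous (expMean r g) ∧ ∀ t, r * ∫ s in (0 : ℝ)..t, expMean r g s =
      (g t - expMean r g t) - (g 0 - expMean r g 0) := by
  set Z : ℝ → ℝ := fun t => ∫ s in Set.Iic t, Real.exp (r * s) * g s with hZ
  have hcont : Continuous (fun s => Real.exp (r * s) * g s) := by fun_prop
  have hY : expMean r g = fun t => g t - r * (Real.exp (-(r * t)) * Z t) :=
    funext fun t => expMean_eq hr hc hg hK t
  have hZ' : ∀ t, HasDerivAt Z (Real.exp (r * t) * g t) t := by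
    intro t
    have hZe : Z = fun t => Z 0 + ∫ s in (0 : ℝ)..t, Real.exp (r * s) * g s := by
      ext t
      rw [← intervalIntegral.integral_Iic_sub_Iic (integrableOn_Iic_exp_mul hc hg hK 0)
        (integrableOn_Iic_exp_mul hc hg hK t)]
      simp [hZ]
    rw [hZe]
    exact (intervalIntegral.integral_hasDerivAt_right (hcont.intervalIntegrable _ _)
      hcont.aestronglyMeasurable.stronglyMeasurableAtFilter hcont.continuousAt).const_add _
  have hW : ∀ t, HasDerivAt (fun t => Real.exp (-(r * t)) * Z t) (expMean r g t) t := by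
    intro t
    have h1 : HasDerivAt (fun t : ℝ => Real.exp (-(r * t))) (Real.exp (-(r * t)) * -(r * 1)) t :=
      (((hasDerivAt_id t).const_mul r).neg).exp
    refine (h1.mul (hZ' t)).congr_deriv ?_
    have he : Real.exp (-(r * t)) * Real.exp (r * t) = 1 := by
      rw [← Real.exp_add, neg_add_cancel, Real.exp_zero]
    rw [hY]
    linear_combination g t * he
  have hYc : Continuous (expMean r g) := by
    rw [hY]
    have : Continuous Z := continuous_iff_continuousAt.2 fun t => (hZ' t).continuousAt
    fun_prop
  refine ⟨hYc, fun t => ?_⟩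
  rw [intervalIntegral.integral_eq_sub_of_hasDerivAt (fun s _ => hW s)
    (hYc.intervalIntegrable _ _), hY]
  ring

end growth

/-! ### The quantitative Kolmogorov continuity theorem -/

lemma eHolderNorm_le_of_forall_edist_le {X Y : Type*} [PseudoEMetricSpace X] [PseudoEMetricSpace Y]
    {r : ℝ≥0} {f : X → Y} {C : ℝ≥0∞}
    (h : ∀ x y, edist (f x) (f y) ≤ C * edist x y ^ (r : ℝ)) : eHolderNorm r f ≤ C := by
  induction C with
  | top => exact le_top
  | coe C => exact HolderWith.eHolderNorm_le h

/-- The weighted sum `∑ₙ 2^(nβq) ∑ₖ |f((k+1)/2ⁿ) - f(k/2ⁿ)|^q` over dyadic increments on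
`[0, 1]`, which controls the `β`-Hölder seminorm of a continuous function. -/
def dyadicSum (q β : ℝ) (f : ℝ → ℝ) : ℝ≥0∞ :=
  ∑' n : ℕ, (2 : ℝ≥0∞) ^ (n * β * q) *
    ∑ k ∈ Finset.range (2 ^ n), edist (f (k / 2 ^ n)) (f ((k + 1) / 2 ^ n)) ^ q

/-- A single dyadic increment is controlled by the weighted sum of all of them. -/
lemma edist_dyadic_le {q β : ℝ} (hq : 0 < q) (f : ℝ → ℝ) {n k : ℕ} (hk : k < 2 ^ n) :
    edist (f (k / 2 ^ n)) (f ((k + 1) / 2 ^ n)) ≤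
      dyadicSum q β f ^ (1 / q) * ((2 : ℝ≥0∞) ^ (-β)) ^ n := by
  set e := edist (f (k / 2 ^ n)) (f ((k + 1) / 2 ^ n)) with he
  have h1 : (2 : ℝ≥0∞) ^ (n * β * q) * e ^ q ≤ dyadicSum q β f := by
    refine le_trans ?_ (ENNReal.le_tsum n)
    gcongr
    exact Finset.single_le_sum (f := fun k : ℕ => edist (f (k / 2 ^ n)) (f ((k + 1) / 2 ^ n)) ^ q)
      (fun _ _ => zero_le) (Finset.mem_range.2 hk)
  have h2 : (2 : ℝ≥0∞) ^ (n * β) * e ≤ dyadicSum q β f ^ (1 / q) := by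
    rw [ENNReal.rpow_mul, ← ENNReal.mul_rpow_of_nonneg _ _ hq.le] at h1
    rw [one_div]
    exact (ENNReal.le_rpow_inv_iff hq).2 h1
  calc e = ((2 : ℝ≥0∞) ^ (n * β) * e) * ((2 : ℝ≥0∞) ^ (-β)) ^ n := by
        rw [← ENNReal.rpow_natCast, ← ENNReal.rpow_mul, mul_right_comm,
          ← ENNReal.rpow_add _ _ two_ne_zero ENNReal.ofNat_ne_top]
        simp [mul_comm]
    _ ≤ _ := by gcongr

/-- The dyadic approximation of `u` from below at level `n`. -/
def dyadicFloor (n : ℕ) (u : ℝ) : ℝ := ⌊2 ^ n * u⌋₊ / 2 ^ n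

lemma tendsto_dyadicFloor {u : ℝ} (hu : 0 ≤ u) :
    Tendsto (fun n => dyadicFloor n u) atTop (𝓝 u) := by
  have := (tendsto_nat_floor_mul_div_atTop hu).comp
    (tendsto_pow_atTop_atTop_of_one_lt (one_lt_two (α := ℝ)))
  refine this.congr fun n => ?_
  simp [dyadicFloor, mul_comm]

lemma dyadicFloor_mem_Icc {u : ℝ} (hu : u ∈ Set.Icc (0 : ℝ) 1) (n : ℕ) :
    dyadicFloor n u ∈ Set.Icc (0 : ℝ) 1 := by
  refine ⟨by unfold dyadicFloor; positivity, ?_⟩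
  rw [dyadicFloor, div_le_one (by positivity)]
  refine (Nat.floor_le (mul_nonneg (by positivity) hu.1)).trans ?_
  nlinarith [hu.2, pow_pos (two_pos (α := ℝ)) n]

lemma edist_dyadicFloor_le {q β : ℝ} (hq : 0 < q) (f : ℝ → ℝ) (n : ℕ) {j k : ℕ}
    (hjk : j ≤ k) (hkj : k ≤ j + 1) (hk : k ≤ 2 ^ n) :
    edist (f (j / 2 ^ n)) (f (k / 2 ^ n)) ≤
      dyadicSum q β f ^ (1 / q) * ((2 : ℝ≥0∞) ^ (-β)) ^ n := by
  obtain rfl | rfl : k = j ∨ k = j + 1 := by omega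
  · simp
  · simpa using edist_dyadic_le hq f (n := n) (k := j) (by omega)

lemma two_rpow_neg_lt_one {β : ℝ} (hβ : 0 < β) : (2 : ℝ≥0∞) ^ (-β) < 1 := by
  rw [ENNReal.rpow_neg, ENNReal.inv_lt_one]
  exact ENNReal.one_lt_rpow (by norm_num) hβ

lemma floor_two_pow_le {u : ℝ} (hu : u ∈ Set.Icc (0 : ℝ) 1) (n : ℕ) : ⌊2 ^ n * u⌋₊ ≤ 2 ^ n := by
  refine Nat.floor_le_of_le ?_
  push_cast
  nlinarith [hu.2, pow_pos (two_pos (α := ℝ)) n]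

/-- Chaining: the telescoping sum over the dyadic approximations of `u` is geometric. -/
lemma edist_dyadicFloor_self_le {q β : ℝ} (hq : 0 < q) (hβ : 0 < β) {f : ℝ → ℝ}
    (hf : ContinuousOn f (Set.Icc 0 1)) {u : ℝ} (hu : u ∈ Set.Icc (0 : ℝ) 1) (n : ℕ) :
    edist (f (dyadicFloor n u)) (f u) ≤
      dyadicSum q β f ^ (1 / q) * ((2 : ℝ≥0∞) ^ (-β)) ^ n / (1 - (2 : ℝ≥0∞) ^ (-β)) := by
  refine edist_le_of_edist_le_geometric_of_tendsto (f := fun n => f (dyadicFloor n u)) _ _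
    (fun n => ?_) ?_ n
  · have h0 : 0 ≤ 2 ^ n * u := mul_nonneg (by positivity) hu.1
    have h1 := Nat.floor_le h0
    have h2 := Nat.lt_floor_add_one (2 ^ n * u)
    have e : dyadicFloor n u = ((2 * ⌊2 ^ n * u⌋₊ : ℕ) : ℝ) / 2 ^ (n + 1) := by
      rw [dyadicFloor, pow_succ]
      push_cast
      field_simp
    rw [e, dyadicFloor]
    refine (edist_dyadicFloor_le (β := β) hq f (n + 1) (Nat.le_floor ?_) ?_
      (floor_two_pow_le hu _)).trans ?_
    · push_cast
      rw [pow_succ]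
      linarith
    · refine Nat.lt_succ_iff.1 ((Nat.floor_lt ?_).2 ?_)
      · exact mul_nonneg (by positivity) hu.1
      · push_cast
        rw [pow_succ]
        linarith
    · rw [pow_succ]
      gcongr
      exact mul_le_of_le_one_right zero_le (two_rpow_neg_lt_one hβ).le
  · exact ((hf u hu).tendsto).comp (tendsto_nhdsWithin_iff.2
      ⟨tendsto_dyadicFloor hu.1, .of_forall fun n => dyadicFloor_mem_Icc hu n⟩)

/-- A continuous function on `[0, 1]` is Hölder continuous with constant a multiple of
`dyadicSum ^ (1 / q)`: two points are joined through their approximations at the dyadic scale of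
their distance. -/
lemma edist_le_dyadicSum {q β γ : ℝ} (hq : 0 < q) (hβ : 0 < β) (hγ : 0 ≤ γ) (hγβ : γ ≤ β)
    {f : ℝ → ℝ} (hf : ContinuousOn f (Set.Icc 0 1)) {u v : ℝ}
    (hu : u ∈ Set.Icc (0 : ℝ) 1) (hv : v ∈ Set.Icc (0 : ℝ) 1) :
    edist (f u) (f v) ≤
      (1 + 2 / (1 - (2 : ℝ≥0∞) ^ (-β))) * (2 : ℝ≥0∞) ^ γ * dyadicSum q β f ^ (1 / q)
        * edist u v ^ γ := by
  wlog huv : u < v generalizing u v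
  · rcases (not_lt.1 huv).eq_or_lt with h | h
    · simp [h]
    · rw [edist_comm, edist_comm u]
      exact this hv hu h
  -- the dyadic scale of `v - u`
  obtain ⟨m, hm1, hm2⟩ := exists_nat_pow_near_of_lt_one (sub_pos.2 huv)
    (by linarith [hu.1, hv.2] : v - u ≤ 1) (by norm_num : (0 : ℝ) < 1 / 2) (by norm_num)
  have hr : ((2 : ℝ≥0∞) ^ (-β)) ^ m ≤ 2 ^ γ * edist u v ^ γ := by
    have e1 : ((2 : ℝ≥0∞) ^ (-β)) ^ m = ((2⁻¹ : ℝ≥0∞) ^ m) ^ β := by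
      rw [← ENNReal.rpow_natCast, ← ENNReal.rpow_natCast, ← ENNReal.rpow_mul, ENNReal.inv_rpow,
        ENNReal.inv_rpow, ← ENNReal.rpow_mul, ← ENNReal.rpow_neg]
      congr 1
      ring
    have e2 : (2⁻¹ : ℝ≥0∞) ^ m = ENNReal.ofReal ((1 / 2) ^ m) := by
      rw [ENNReal.ofReal_pow (by norm_num), one_div, ENNReal.ofReal_inv_of_pos two_pos]
      simp
    rw [e1, ← ENNReal.mul_rpow_of_nonneg _ _ hγ]
    refine (ENNReal.rpow_le_rpow_of_exponent_ge
      (pow_le_one₀ zero_le (ENNReal.inv_le_one.2 (by norm_num))) hγβ).trans ?_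
    gcongr
    rw [e2, edist_comm, edist_dist, Real.dist_eq, abs_of_pos (sub_pos.2 huv),
      show (2 : ℝ≥0∞) = ENNReal.ofReal 2 by simp, ← ENNReal.ofReal_mul two_pos.le]
    refine ENNReal.ofReal_le_ofReal ?_
    rw [pow_succ] at hm1
    linarith
  have hclose : edist (f (dyadicFloor m u)) (f (dyadicFloor m v)) ≤
      dyadicSum q β f ^ (1 / q) * ((2 : ℝ≥0∞) ^ (-β)) ^ m := by
    have hp : (0 : ℝ) < 2 ^ m := by positivity
    refine edist_dyadicFloor_le hq f m (Nat.floor_mono (by gcongr)) ?_ (floor_two_pow_le hv m)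
    refine Nat.lt_succ_iff.1 ((Nat.floor_lt (mul_nonneg hp.le hv.1)).2 ?_)
    push_cast
    have h2m : (2 : ℝ) ^ m * (1 / 2) ^ m = 1 := by
      rw [← mul_pow]
      norm_num
    have := Nat.lt_floor_add_one (2 ^ m * u)
    nlinarith
  have h1 := edist_dyadicFloor_self_le hq hβ hf hu m
  have h2 := edist_dyadicFloor_self_le hq hβ hf hv m
  rw [edist_comm] at h1
  calc edist (f u) (f v) ≤ edist (f u) (f (dyadicFloor m u))
        + edist (f (dyadicFloor m u)) (f (dyadicFloor m v)) + edist (f (dyadicFloor m v)) (f v) :=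
        edist_triangle4 _ _ _ _
    _ ≤ _ + _ + _ := add_le_add (add_le_add h1 hclose) h2
    _ = (1 + 2 / (1 - (2 : ℝ≥0∞) ^ (-β))) * dyadicSum q β f ^ (1 / q)
        * ((2 : ℝ≥0∞) ^ (-β)) ^ m := by
        simp only [div_eq_mul_inv]
        ring
    _ ≤ (1 + 2 / (1 - (2 : ℝ≥0∞) ^ (-β))) * dyadicSum q β f ^ (1 / q)
        * (2 ^ γ * edist u v ^ γ) := by gcongr
    _ = _ := by ring

lemma holderSeminorm_le_dyadicSum {q β t : ℝ} {γ : ℝ≥0} (hq : 0 < q) (hβ : 0 < β)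
    (hγβ : γ ≤ β) (ht : 0 < t) {θ : ℝ → ℝ} (hθ : ContinuousOn θ (Set.Icc 0 t)) :
    holderSeminorm γ t θ ≤
      (1 + 2 / (1 - (2 : ℝ≥0∞) ^ (-β))) * (2 : ℝ≥0∞) ^ (γ : ℝ) * ENNReal.ofReal (t ^ (-(γ : ℝ)))
        * dyadicSum q β (fun u => θ (t * u)) ^ (1 / q) := by
  refine eHolderNorm_le_of_forall_edist_le fun u v => ?_
  have hmem : ∀ w : Set.Icc (0 : ℝ) t, (w : ℝ) / t ∈ Set.Icc (0 : ℝ) 1 := fun w =>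
    ⟨div_nonneg w.2.1 ht.le, (div_le_one ht).2 w.2.2⟩
  have hf : ContinuousOn (fun u => θ (t * u)) (Set.Icc 0 1) := by
    refine hθ.comp (by fun_prop) fun w hw => ⟨mul_nonneg ht.le hw.1, ?_⟩
    nlinarith [hw.2]
  have := edist_le_dyadicSum hq hβ γ.coe_nonneg hγβ hf (hmem u) (hmem v)
  simp only [mul_div_cancel₀ _ ht.ne'] at this
  refine this.trans_eq ?_
  have e : edist ((u : ℝ) / t) ((v : ℝ) / t) ^ (γ : ℝ) =
      ENNReal.ofReal (t ^ (-(γ : ℝ))) * edist u v ^ (γ : ℝ) := by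
    rw [Subtype.edist_eq, edist_dist, edist_dist, Real.dist_eq, Real.dist_eq, ← sub_div, abs_div,
      abs_of_pos ht, ENNReal.ofReal_div_of_pos ht, div_eq_mul_inv,
      ENNReal.mul_rpow_of_nonneg _ _ γ.coe_nonneg, mul_comm, Real.rpow_neg ht.le,
      ENNReal.ofReal_inv_of_pos (by positivity), ENNReal.inv_rpow,
      ENNReal.ofReal_rpow_of_pos ht]
  rw [e]
  ring

section process

variable {Ω : Type*} [MeasurableSpace Ω] {P : Measure Ω}

/-- The `2ⁿ` increments at level `n` contribute `2^(n(βq + 1 - γq))`, and these sum to a geometric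
series. -/
lemma lintegral_dyadicSum_le {X : ℝ → Ω → ℝ} {q β γ : ℝ} {K : ℝ≥0∞}
    (hX : ∀ u, AEMeasurable (X u) P)
    (hK : ∀ u ∈ Set.Icc (0 : ℝ) 1, ∀ v ∈ Set.Icc (0 : ℝ) 1,
      ∫⁻ ω, edist (X u ω) (X v ω) ^ q ∂P ≤ K * edist u v ^ (γ * q)) :
    ∫⁻ ω, dyadicSum q β (fun u => X u ω) ∂P ≤
      K * (1 - (2 : ℝ≥0∞) ^ (β * q + 1 - γ * q))⁻¹ := by
  have hm : ∀ u v, AEMeasurable (fun ω => edist (X u ω) (X v ω) ^ q) P := fun u v =>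
    ((hX u).edist (hX v)).pow_const q
  simp only [dyadicSum]
  rw [lintegral_tsum fun n => (Finset.aemeasurable_fun_sum _ fun k _ => hm _ _).const_mul _,
    ← ENNReal.tsum_geometric, ← ENNReal.tsum_mul_left]
  refine ENNReal.tsum_le_tsum fun n => ?_
  rw [lintegral_const_mul'' _ (Finset.aemeasurable_fun_sum _ fun k _ => hm _ _),
    lintegral_finsetSum' _ fun k _ => hm _ _]
  have hinc : ∀ k ∈ Finset.range (2 ^ n),
      ∫⁻ ω, edist (X (k / 2 ^ n) ω) (X ((k + 1) / 2 ^ n) ω) ^ q ∂P ≤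
        K * (2 : ℝ≥0∞) ^ (-(n * (γ * q))) := by
    intro k hk
    have hk' : ((k : ℝ) + 1) ≤ 2 ^ n := by exact_mod_cast Finset.mem_range.1 hk
    have hp : (0 : ℝ) < 2 ^ n := by positivity
    refine (hK _ ⟨by positivity, (div_le_one hp).2 (by linarith)⟩ _
      ⟨by positivity, (div_le_one hp).2 hk'⟩).trans_eq ?_
    rw [edist_comm, edist_dist, Real.dist_eq, ← sub_div, add_sub_cancel_left,
      abs_of_pos (by positivity), one_div, ENNReal.ofReal_inv_of_pos hp,
      ENNReal.ofReal_pow two_pos.le, ENNReal.inv_rpow, ← ENNReal.rpow_natCast, ← ENNReal.rpow_mul,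
      ← ENNReal.rpow_neg]
    simp
  calc _ ≤ (2 : ℝ≥0∞) ^ (n * β * q) *
        ∑ k ∈ Finset.range (2 ^ n), K * (2 : ℝ≥0∞) ^ (-(n * (γ * q))) := by
        gcongr with k hk
        exact hinc k hk
    _ = K * ((2 : ℝ≥0∞) ^ (n * β * q) * (2 : ℝ≥0∞) ^ (n : ℝ) *
          (2 : ℝ≥0∞) ^ (-(n * (γ * q)))) := by
        rw [Finset.sum_const, Finset.card_range, nsmul_eq_mul, ENNReal.rpow_natCast]
        push_cast
        ring
    _ = _ := by
        rw [← ENNReal.rpow_natCast, ← ENNReal.rpow_mul,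
          ← ENNReal.rpow_add _ _ two_ne_zero ENNReal.ofNat_ne_top,
          ← ENNReal.rpow_add _ _ two_ne_zero ENNReal.ofNat_ne_top]
        congr 2
        ring

/-- **Quantitative Kolmogorov continuity theorem.** If the increments of a continuous process are
bounded in `L^q` by `K |u - v|^γ`, its `γ'`-Hölder seminorm on `[0, t]` is bounded in `L^q` by a
constant times `K t^(γ-γ')`, provided `γ' + 1 / q < γ`. The constant depends on neither the process
nor the interval. -/
theorem exists_eLpNorm_holderSeminorm_le (P : Measure Ω) (γ' : ℝ≥0) {γ q : ℝ} (hq : 0 < q)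
    (hγ : γ' + 1 / q < γ) :
    ∃ A : ℝ≥0, ∀ (X : ℝ → Ω → ℝ) (K : ℝ≥0∞) (t : ℝ), 0 < t → (∀ u, AEMeasurable (X u) P) →
      (∀ᵐ ω ∂P, ContinuousOn (fun u => X u ω) (Set.Icc 0 t)) →
      (∀ u ∈ Set.Icc 0 t, ∀ v ∈ Set.Icc 0 t,
        eLpNorm (fun ω => X u ω - X v ω) (ENNReal.ofReal q) P ≤ K * edist u v ^ γ) →
      eLpNorm (fun ω => holderSeminorm γ' t (fun u => X u ω)) (ENNReal.ofReal q) P ≤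
        A * K * ENNReal.ofReal (t ^ (γ - γ')) := by
  obtain ⟨β, hβ1, hβ2⟩ : ∃ β : ℝ, γ' < β ∧ β + 1 / q < γ :=
    ⟨(γ' + (γ - 1 / q)) / 2, by linarith, by linarith⟩
  have hβ : 0 < β := γ'.coe_nonneg.trans_lt hβ1
  have hβ3 : β * q + 1 - γ * q < 0 := by
    have : (β + 1 / q) * q < γ * q := by gcongr
    rw [add_mul, one_div_mul_cancel hq.ne'] at this
    linarith
  set A₁ : ℝ≥0∞ := (1 + 2 / (1 - (2 : ℝ≥0∞) ^ (-β))) * (2 : ℝ≥0∞) ^ (γ' : ℝ) with hA₁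
  set A₂ : ℝ≥0∞ := ((1 - (2 : ℝ≥0∞) ^ (β * q + 1 - γ * q))⁻¹) ^ (1 / q) with hA₂
  have hA₁top : A₁ ≠ ⊤ := by
    refine ENNReal.mul_ne_top (ENNReal.add_ne_top.2 ⟨ENNReal.one_ne_top, ENNReal.div_ne_top
      ENNReal.ofNat_ne_top (tsub_pos_of_lt (two_rpow_neg_lt_one hβ)).ne'⟩)
      (ENNReal.rpow_ne_top_of_nonneg γ'.coe_nonneg ENNReal.ofNat_ne_top)
  have hA₂top : A₂ ≠ ⊤ := by
    refine ENNReal.rpow_ne_top_of_nonneg (by positivity) (ENNReal.inv_ne_top.2 ?_)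
    have := two_rpow_neg_lt_one (neg_pos.2 hβ3)
    rw [neg_neg] at this
    exact (tsub_pos_of_lt this).ne'
  refine ⟨(A₁ * A₂).toNNReal, fun X K t ht hX hcont hK => ?_⟩
  rw [ENNReal.coe_toNNReal (ENNReal.mul_ne_top hA₁top hA₂top)]
  have hq0 : ENNReal.ofReal q ≠ 0 := by simpa using hq
  have hqr : (ENNReal.ofReal q).toReal = q := ENNReal.toReal_ofReal hq.le
  have hscaled : ∫⁻ ω, dyadicSum q β (fun u => X (t * u) ω) ∂P ≤
      (K * ENNReal.ofReal (t ^ γ)) ^ q * (1 - (2 : ℝ≥0∞) ^ (β * q + 1 - γ * q))⁻¹ := by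
    refine lintegral_dyadicSum_le (X := fun u => X (t * u)) (fun u => hX _) ?_
    intro u hu v hv
    have hmem : ∀ w ∈ Set.Icc (0 : ℝ) 1, t * w ∈ Set.Icc 0 t := fun w hw =>
      ⟨mul_nonneg ht.le hw.1, by nlinarith [hw.2]⟩
    have h1 := hK _ (hmem u hu) _ (hmem v hv)
    rw [eLpNorm_eq_lintegral_rpow_enorm_toReal hq0 ENNReal.ofReal_ne_top, hqr, one_div,
      ENNReal.rpow_inv_le_iff hq] at h1
    simp only [← edist_eq_enorm_sub] at h1
    refine h1.trans_eq ?_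
    have : edist (t * u) (t * v) ^ γ = ENNReal.ofReal (t ^ γ) * edist u v ^ γ := by
      rw [edist_dist, edist_dist, Real.dist_eq, Real.dist_eq, ← mul_sub, abs_mul, abs_of_pos ht,
        ENNReal.ofReal_mul ht.le, ENNReal.mul_rpow_of_ne_top ENNReal.ofReal_ne_top
        ENNReal.ofReal_ne_top, ENNReal.ofReal_rpow_of_pos ht]
    rw [this, ← mul_assoc, ENNReal.mul_rpow_of_nonneg _ _ hq.le, ← ENNReal.rpow_mul]
  have hpow : ENNReal.ofReal (t ^ (-(γ' : ℝ))) * ENNReal.ofReal (t ^ γ)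
      = ENNReal.ofReal (t ^ (γ - γ')) := by
    rw [← ENNReal.ofReal_mul (by positivity), ← Real.rpow_add ht]
    congr 2
    ring
  set c := A₁ * ENNReal.ofReal (t ^ (-(γ' : ℝ))) with hc
  have hctop : c ≠ ⊤ := ENNReal.mul_ne_top hA₁top ENNReal.ofReal_ne_top
  rw [eLpNorm_eq_lintegral_rpow_enorm_toReal hq0 ENNReal.ofReal_ne_top, hqr]
  calc _ ≤ (∫⁻ ω, c ^ q * dyadicSum q β (fun u => X (t * u) ω) ∂P) ^ (1 / q) := by
        gcongr ?_ ^ (1 / q)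
        refine lintegral_mono_ae ?_
        filter_upwards [hcont] with ω hω
        have := holderSeminorm_le_dyadicSum (q := q) hq hβ hβ1.le ht hω
        calc _ ≤ (c * dyadicSum q β (fun u => X (t * u) ω) ^ (1 / q)) ^ q := by
              rw [enorm_eq_self]
              gcongr
          _ = _ := by
              rw [ENNReal.mul_rpow_of_nonneg _ _ hq.le, ← ENNReal.rpow_mul,
                one_div_mul_cancel hq.ne', ENNReal.rpow_one]
    _ = (c ^ q * ∫⁻ ω, dyadicSum q β (fun u => X (t * u) ω) ∂P) ^ (1 / q) := by
        rw [lintegral_const_mul' _ _ (ENNReal.rpow_ne_top_of_nonneg hq.le hctop)]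
    _ ≤ (c ^ q * ((K * ENNReal.ofReal (t ^ γ)) ^ q
          * (1 - (2 : ℝ≥0∞) ^ (β * q + 1 - γ * q))⁻¹)) ^ (1 / q) := by gcongr
    _ = c * (K * ENNReal.ofReal (t ^ γ)) * A₂ := by
        rw [← mul_assoc, ← ENNReal.mul_rpow_of_nonneg _ _ hq.le,
          ENNReal.mul_rpow_of_nonneg _ _ (by positivity : 0 ≤ 1 / q), ← ENNReal.rpow_mul,
          mul_one_div_cancel hq.ne', ENNReal.rpow_one]
    _ = A₁ * A₂ * K * (ENNReal.ofReal (t ^ (-(γ' : ℝ))) * ENNReal.ofReal (t ^ γ)) := by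
        rw [hc]
        ring
    _ = _ := by rw [hpow]

end process

/-! ### Measurability of Hölder seminorms, continuous modifications and mixtures -/

/-- Distinct points are needed only because of `∞ * 0 = 0`. -/
lemma edist_le_eHolderNorm_mul {X Y : Type*} [MetricSpace X] [PseudoEMetricSpace Y]
    {r : ℝ≥0} {f : X → Y} {x y : X} (hxy : x ≠ y) :
    edist (f x) (f y) ≤ eHolderNorm r f * edist x y ^ (r : ℝ) := by
  by_cases h : MemHolder r f
  · rw [eHolderNorm]
    have hne : edist x y ^ (r : ℝ) ≠ 0 :=
      (ENNReal.rpow_pos (edist_pos.2 hxy) (edist_ne_top _ _)).ne'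
    have hnt : edist x y ^ (r : ℝ) ≠ ⊤ :=
      ENNReal.rpow_ne_top_of_nonneg r.coe_nonneg (edist_ne_top _ _)
    rw [← ENNReal.div_le_iff hne hnt]
    exact le_iInf₂ fun C hC => (ENNReal.div_le_iff hne hnt).2 (hC x y)
  · rw [eHolderNorm_eq_top.2 h, ENNReal.top_mul]
    · exact le_top
    · exact (ENNReal.rpow_pos (edist_pos.2 hxy) (edist_ne_top _ _)).ne'

/-- For a continuous function the Hölder seminorm is a supremum over pairs from a dense family,
which may be taken countable. Pairs of equal points contribute `0 / 0 = 0` or `0 / 1 = 0`. -/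
lemma eHolderNorm_eq_iSup_denseRange {X Y ι : Type*} [MetricSpace X] [PseudoEMetricSpace Y]
    (r : ℝ≥0) {f : X → Y} (hf : Continuous f) {d : ι → X} (hd : DenseRange d) :
    eHolderNorm r f = ⨆ p : ι × ι,
      edist (f (d p.1)) (f (d p.2)) / edist (d p.1) (d p.2) ^ (r : ℝ) := by
  refine le_antisymm ?_ (iSup_le fun p => ?_)
  · set C := ⨆ p : ι × ι, edist (f (d p.1)) (f (d p.2)) / edist (d p.1) (d p.2) ^ (r : ℝ)
    rcases eq_or_ne C ⊤ with hCt | hCt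
    · rw [hCt]
      exact le_top
    refine eHolderNorm_le_of_forall_edist_le fun x y => ?_
    have hclosed : IsClosed {p : X × X | edist (f p.1) (f p.2) ≤ C * edist p.1 p.2 ^ (r : ℝ)} := by
      refine isClosed_le (by fun_prop) ?_
      exact (ENNReal.continuous_const_mul hCt).comp
        (ENNReal.continuous_rpow_const.comp (by fun_prop))
    refine (hd.prodMap hd).induction_on (p := fun p => edist (f p.1) (f p.2)
      ≤ C * edist p.1 p.2 ^ (r : ℝ)) (x, y) hclosed fun p => ?_
    simp only [Prod.map_fst, Prod.map_snd]
    by_cases h : d p.1 = d p.2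
    · simp [h]
    · rw [← ENNReal.div_le_iff (ENNReal.rpow_pos (edist_pos.2 h) (edist_ne_top _ _)).ne'
        (ENNReal.rpow_ne_top_of_nonneg r.coe_nonneg (edist_ne_top _ _))]
      exact le_iSup (fun p : ι × ι =>
        edist (f (d p.1)) (f (d p.2)) / edist (d p.1) (d p.2) ^ (r : ℝ)) p
  · by_cases h : d p.1 = d p.2
    · simp [h]
    · exact ENNReal.div_le_of_le_mul (edist_le_eHolderNorm_mul h)

section process

variable {Ω : Type*} [MeasurableSpace Ω] {P : Measure Ω}

lemma aemeasurable_holderSeminorm (r : ℝ≥0) {t : ℝ} (ht : 0 ≤ t) {X : ℝ → Ω → ℝ}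
    (hX : ∀ u, AEMeasurable (X u) P)
    (hcont : ∀ᵐ ω ∂P, ContinuousOn (fun u => X u ω) (Set.Icc 0 t)) :
    AEMeasurable (fun ω => holderSeminorm r t (fun u => X u ω)) P := by
  have : Nonempty (Set.Icc (0 : ℝ) t) := ⟨⟨0, le_rfl, ht⟩⟩
  have hd := TopologicalSpace.denseRange_denseSeq (Set.Icc (0 : ℝ) t)
  set d := TopologicalSpace.denseSeq (Set.Icc (0 : ℝ) t)
  have hm : AEMeasurable (fun ω => ⨆ p : ℕ × ℕ,
      edist (X (d p.1) ω) (X (d p.2) ω) / edist (d p.1) (d p.2) ^ (r : ℝ)) P :=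
    AEMeasurable.iSup fun p => ((hX _).edist (hX _)).div_const _
  refine hm.congr ?_
  filter_upwards [hcont] with ω hω
  exact (eHolderNorm_eq_iSup_denseRange r hω.domRestrict hd).symm

/-- A process with almost surely continuous paths agrees, outside one null set, with a jointly
measurable one. The null set also collects the exceptional sets of measurable versions at rational
times. -/
lemma exists_measurable_continuous_modification {X : ℝ → Ω → ℝ} (hX : ∀ u, AEMeasurable (X u) P)
    (hcont : ∀ᵐ ω ∂P, Continuous fun u => X u ω) :
    ∃ X' : ℝ → Ω → ℝ, Measurable (Function.uncurry X') ∧ ∀ᵐ ω ∂P, ∀ u, X' u ω = X u ω := by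
  have hae : ∀ᵐ ω ∂P, (Continuous fun u => X u ω) ∧
      ∀ q : ℚ, X q ω = (hX q).mk (X q) ω := by
    filter_upwards [hcont, ae_all_iff.2 fun q : ℚ => (hX q).ae_eq_mk] with ω h1 h2 using ⟨h1, h2⟩
  obtain ⟨S, hS, hSm, hSp⟩ := hae.exists_measurable_mem
  refine ⟨fun u => S.indicator (X u), ?_, ?_⟩
  · refine measurable_uncurry_of_continuous_of_measurable (fun ω => ?_) fun u => ?_
    · by_cases hω : ω ∈ S
      · simpa [hω] using (hSp ω hω).1
      · simp only [Set.indicator_of_notMem hω]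
        fun_prop
    · obtain ⟨q, hq⟩ : ∃ q : ℕ → ℚ, Tendsto (fun n => (q n : ℝ)) atTop (𝓝 u) := by
        have hu := Rat.denseRange_cast (𝕜 := ℝ) u
        obtain ⟨x, hx, hxt⟩ := mem_closure_iff_seq_limit.1 hu
        choose q hq using hx
        exact ⟨q, by simpa [hq] using hxt⟩
      refine measurable_of_tendsto_metrizable
        (f := fun n => S.indicator ((hX (q n)).mk (X (q n))))
        (fun n => ((hX (q n)).measurable_mk).indicator hSm) (tendsto_pi_nhds.2 fun ω => ?_)
      by_cases hω : ω ∈ S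
      · simp only [Set.indicator_of_mem hω, ← (hSp ω hω).2]
        exact ((hSp ω hω).1.tendsto u).comp hq
      · simp [Set.indicator_of_notMem hω]
  · filter_upwards [hS] with ω hω u using Set.indicator_of_mem hω _

/-- Jensen's inequality for a mixture of random variables. -/
lemma eLpNorm_integral_le {ν : Measure ℝ} [IsProbabilityMeasure ν] [SFinite P] {q : ℝ} (hq : 1 ≤ q)
    {G : ℝ → Ω → ℝ} (hG : Measurable (Function.uncurry G)) {b : ℝ → ℝ≥0∞}
    (hb : ∀ᵐ u ∂ν, eLpNorm (G u) (ENNReal.ofReal q) P ≤ b u) :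
    eLpNorm (fun ω => ∫ u, G u ω ∂ν) (ENNReal.ofReal q) P ≤ (∫⁻ u, b u ^ q ∂ν) ^ (1 / q) := by
  have hq' : 0 < q := by linarith
  have hq0 : ENNReal.ofReal q ≠ 0 := by simpa using hq'
  have hqr : (ENNReal.ofReal q).toReal = q := ENNReal.toReal_ofReal hq'.le
  rw [eLpNorm_eq_lintegral_rpow_enorm_toReal hq0 ENNReal.ofReal_ne_top, hqr]
  gcongr ?_ ^ (1 / q)
  have hmeas : ∀ ω, Measurable fun u => G u ω := fun ω => hG.comp measurable_prodMk_right
  have hjensen : ∀ ω, ‖∫ u, G u ω ∂ν‖ₑ ^ q ≤ ∫⁻ u, ‖G u ω‖ₑ ^ q ∂ν := by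
    intro ω
    have h1 := eLpNorm_le_eLpNorm_of_exponent_le (μ := ν) (p := 1) (q := ENNReal.ofReal q)
      (by simpa using ENNReal.ofReal_le_ofReal hq) (hmeas ω).aestronglyMeasurable
    rw [eLpNorm_one_eq_lintegral_enorm,
      eLpNorm_eq_lintegral_rpow_enorm_toReal hq0 ENNReal.ofReal_ne_top, hqr, one_div] at h1
    exact (ENNReal.le_rpow_inv_iff hq').1 ((enorm_integral_le_lintegral_enorm _).trans h1)
  calc _ ≤ ∫⁻ ω, ∫⁻ u, ‖G u ω‖ₑ ^ q ∂ν ∂P := lintegral_mono hjensen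
    _ = ∫⁻ u, ∫⁻ ω, ‖G u ω‖ₑ ^ q ∂P ∂ν :=
        lintegral_lintegral_swap ((hG.comp measurable_swap).enorm.pow_const q).aemeasurable
    _ ≤ _ := by
        refine lintegral_mono_ae ?_
        filter_upwards [hb] with u hu
        rwa [eLpNorm_eq_lintegral_rpow_enorm_toReal hq0 ENNReal.ofReal_ne_top, hqr, one_div,
          ENNReal.rpow_inv_le_iff hq'] at hu

end process

/-- The moments of the exponential law. The weighted density is a multiple of a gamma density. -/
lemma lintegral_rpow_expMeasure {r a : ℝ} (hr : 0 < r) (ha : 0 < a) :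
    ∫⁻ u, ENNReal.ofReal (|u| ^ a) ∂expMeasure r =
      ENNReal.ofReal (Real.Gamma (a + 1) * r⁻¹ ^ a) := by
  have hG : 0 < Real.Gamma (a + 1) := Real.Gamma_pos_of_pos (by linarith)
  rw [expMeasure_eq_withDensity, lintegral_withDensity_eq_lintegral_mul _
    (measurable_exponentialPDF r) (by fun_prop)]
  have : ∀ u, (exponentialPDF r * fun u => ENNReal.ofReal (|u| ^ a)) u =
      ENNReal.ofReal (Real.Gamma (a + 1) * r⁻¹ ^ a) * gammaPDF (a + 1) r u := by
    intro u
    rw [Pi.mul_apply]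
    rcases lt_or_ge u 0 with hu | hu
    · rw [exponentialPDF_of_neg hu, gammaPDF_of_neg hu, zero_mul, mul_zero]
    · rw [exponentialPDF_of_nonneg hu, gammaPDF_of_nonneg hu, ← ENNReal.ofReal_mul (by positivity),
        ← ENNReal.ofReal_mul (by positivity), abs_of_nonneg hu, Real.rpow_add hr, Real.rpow_one,
        add_sub_cancel_right, Real.inv_rpow hr.le]
      congr 1
      field_simp
  rw [lintegral_congr this, lintegral_const_mul _ ?_,
    lintegral_gammaPDF_eq_one (by linarith) hr, mul_one]
  exact (measurable_gammaPDFReal _ _).ennreal_ofReal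

/-! ### Increments and growth of fractional Brownian motion -/

variable {Ω : Type*} [MeasurableSpace Ω] {P : Measure Ω} {H : ℝ} {B : ℝ → Ω → ℝ}

/-- The `L^q` norm of the standard normal distribution. -/
def gaussianNorm (q : ℝ) : ℝ≥0∞ := eLpNorm id (ENNReal.ofReal q) (gaussianReal 0 1)

lemma gaussianNorm_ne_top (q : ℝ) : gaussianNorm q ≠ ⊤ :=
  (memLp_id_gaussianReal' _ ENNReal.ofReal_ne_top).2.ne

namespace IsTwoSidedFBM

lemma aemeasurable (hB : IsTwoSidedFBM H B P) (t : ℝ) : AEMeasurable (B t) P :=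
  hB.gaussian.aemeasurable t

lemma variance_sub_eq (hH : 0 < H) (hB : IsTwoSidedFBM H B P) (s t : ℝ) :
    Var[B t - B s; P] = |t - s| ^ (2 * H) := by
  have := hB.gaussian.isProbabilityMeasure
  have h0 : (0 : ℝ) ^ (2 * H) = 0 := Real.zero_rpow (by linarith)
  rw [variance_sub (hB.gaussian.hasGaussianLaw_eval t).memLp_two
    (hB.gaussian.hasGaussianLaw_eval s).memLp_two, ← covariance_self (hB.aemeasurable t),
    ← covariance_self (hB.aemeasurable s), hB.cov, hB.cov, hB.cov, abs_sub_comm s t, sub_self,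
    sub_self, abs_zero, h0]
  ring

lemma map_sub_eq (hH : 0 < H) (hB : IsTwoSidedFBM H B P) (s t : ℝ) :
    P.map (B t - B s) = (gaussianReal 0 1).map (fun x => |t - s| ^ H * x) := by
  have := hB.gaussian.isProbabilityMeasure
  rw [hB.gaussian.hasGaussianLaw_sub.map_eq_gaussianReal, gaussianReal_map_const_mul,
    hB.variance_sub_eq hH]
  congr 1
  · simp only [Pi.sub_apply, mul_zero]
    rw [integral_sub (hB.gaussian.hasGaussianLaw_eval t).integrable
      (hB.gaussian.hasGaussianLaw_eval s).integrable, hB.centred, hB.centred, sub_zero]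
  · ext
    rw [Real.coe_toNNReal _ (by positivity)]
    simp only [NNReal.coe_mk, mul_one]
    rw [mul_comm, Real.rpow_mul (abs_nonneg _), Real.rpow_two]

lemma eLpNorm_sub (hH : 0 < H) (hB : IsTwoSidedFBM H B P) (q s t : ℝ) :
    eLpNorm (B t - B s) (ENNReal.ofReal q) P = gaussianNorm q * edist t s ^ H := by
  have hm : AEMeasurable (B t - B s) P := (hB.aemeasurable t).sub (hB.aemeasurable s)
  have h1 := eLpNorm_map_measure (p := ENNReal.ofReal q) (g := id) (f := B t - B s) (μ := P)
    measurable_id.aestronglyMeasurable hm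
  rw [Function.id_comp] at h1
  rw [← h1, hB.map_sub_eq hH, eLpNorm_map_measure measurable_id.aestronglyMeasurable
    (by fun_prop)]
  have : id ∘ (fun x : ℝ => |t - s| ^ H * x) = (|t - s| ^ H) • (id : ℝ → ℝ) := by
    ext x
    simp
  rw [this, eLpNorm_const_smul, edist_dist, Real.dist_eq, gaussianNorm, mul_comm,
    Real.enorm_eq_ofReal (by positivity), ENNReal.ofReal_rpow_of_nonneg (abs_nonneg _) hH.le]

/-- Almost surely the paths of a two-sided fractional Brownian motion grow subexponentially
at `-∞`. -/
lemma ae_exists_le_exp (hH : 0 < H) (hB : IsTwoSidedFBM H B P) {δ : ℝ} (hδ : 0 < δ) :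
    ∀ᵐ ω ∂P, ∃ K, ∀ s ≤ 0, |B s ω| ≤ K * Real.exp (-(δ * s)) := by
  -- this exponent exceeds `1 / H` and turns `n ^ (H * q)` into `n ^ 2`
  set q : ℝ := 2 / H with hq
  have hq0 : 0 < q := by positivity
  have hHq : H * q = 2 := by rw [hq]; field_simp
  obtain ⟨A, hA⟩ := exists_eLpNorm_holderSeminorm_le P 0 (γ := H) hq0 (by
    rw [hq]; simp; linarith)
  have hcont : ∀ n : ℕ, ∀ᵐ ω ∂P, ContinuousOn (fun u => B (-u) ω) (Set.Icc 0 (n : ℝ)) := by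
    intro n
    filter_upwards [hB.cont] with ω hω
    exact (hω.comp continuous_neg).continuousOn
  set O : ℕ → Ω → ℝ≥0∞ := fun n ω => holderSeminorm 0 n (fun u => B (-u) ω) with hO
  have hOm : ∀ n, AEMeasurable (O n) P := fun n =>
    aemeasurable_holderSeminorm (X := fun u => B (-u)) 0 (Nat.cast_nonneg n)
      (fun u => hB.aemeasurable _) (hcont n)
  have hOi : ∀ n : ℕ, ∫⁻ ω, O (n + 1) ω ^ q ∂P ≤
      (A * gaussianNorm q) ^ q * ENNReal.ofReal (((n + 1 : ℕ) : ℝ) ^ 2) := by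
    intro n
    have h1 := hA (fun u => B (-u)) (gaussianNorm q) ((n + 1 : ℕ) : ℝ) (by positivity)
      (fun u => hB.aemeasurable _) (hcont _) (fun u _ v _ => by
        rw [← edist_neg_neg u v]
        exact (hB.eLpNorm_sub hH q (-v) (-u)).le)
    rw [eLpNorm_eq_lintegral_rpow_enorm_toReal (by simpa using hq0) ENNReal.ofReal_ne_top,
      ENNReal.toReal_ofReal hq0.le, one_div, ENNReal.rpow_inv_le_iff hq0,
      ENNReal.mul_rpow_of_nonneg _ _ hq0.le, NNReal.coe_zero, sub_zero,
      ENNReal.ofReal_rpow_of_nonneg (by positivity) hq0.le, ← Real.rpow_mul (by positivity), hHq,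
      Real.rpow_two] at h1
    simpa only [enorm_eq_self] using h1
  set a : ℕ → ℝ≥0∞ := fun n => ENNReal.ofReal (Real.exp (-(δ * q) * ((n + 1 : ℕ) : ℝ))) with ha
  -- exponential weights make the expected sum of the oscillations over `[-n, 0]` finite
  have hsum : ∫⁻ ω, ∑' n, a n * O (n + 1) ω ^ q ∂P ≠ ⊤ := by
    rw [lintegral_tsum fun n => ((hOm _).pow_const q).const_mul _]
    refine ne_top_of_le_ne_top (b := (A * gaussianNorm q) ^ q * ∑' n : ℕ, ENNReal.ofReal
      (((n + 1 : ℕ) : ℝ) ^ 2 * Real.exp (-(δ * q) * ((n + 1 : ℕ) : ℝ)))) ?_ ?_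
    · refine ENNReal.mul_ne_top (ENNReal.rpow_ne_top_of_nonneg hq0.le
        (ENNReal.mul_ne_top ENNReal.coe_ne_top (gaussianNorm_ne_top q))) ?_
      have hs : Summable fun n : ℕ => ((n + 1 : ℕ) : ℝ) ^ 2 *
          Real.exp (-(δ * q) * ((n + 1 : ℕ) : ℝ)) :=
        (summable_nat_add_iff 1).2 (Real.summable_pow_mul_exp_neg_nat_mul 2
          (by positivity : 0 < δ * q))
      exact hs.tsum_ofReal_ne_top
    · rw [← ENNReal.tsum_mul_left]
      refine ENNReal.tsum_le_tsum fun n => ?_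
      rw [lintegral_const_mul'' _ ((hOm _).pow_const q), ENNReal.ofReal_mul (by positivity)]
      calc _ ≤ a n * ((A * gaussianNorm q) ^ q * ENNReal.ofReal (((n + 1 : ℕ) : ℝ) ^ 2)) := by
            gcongr
            exact hOi n
        _ = _ := by rw [ha]; ring
  have hfin := ae_lt_top' (AEMeasurable.tsum fun n =>
    ((hOm (n + 1)).pow_const q).const_mul (a n)) hsum
  filter_upwards [hfin] with ω hω
  set S := ∑' n, a n * O (n + 1) ω ^ q
  have hSle : ∀ n : ℕ, O (n + 1) ω ≤
      S ^ (1 / q) * ENNReal.ofReal (Real.exp (δ * ((n + 1 : ℕ) : ℝ))) := by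
    intro n
    have h1 : a n * O (n + 1) ω ^ q ≤ S := ENNReal.le_tsum n
    have h2 : a n = ENNReal.ofReal (Real.exp (-(δ * ((n + 1 : ℕ) : ℝ)))) ^ q := by
      rw [ENNReal.ofReal_rpow_of_pos (Real.exp_pos _), ← Real.exp_mul]
      simp only [ha]
      congr 2
      ring
    rw [h2, ← ENNReal.mul_rpow_of_nonneg _ _ hq0.le, ← ENNReal.le_rpow_inv_iff hq0,
      ← one_div] at h1
    calc O (n + 1) ω = ENNReal.ofReal (Real.exp (-(δ * ((n + 1 : ℕ) : ℝ)))) * O (n + 1) ω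
          * ENNReal.ofReal (Real.exp (δ * ((n + 1 : ℕ) : ℝ))) := by
          rw [mul_right_comm, ← ENNReal.ofReal_mul (Real.exp_pos _).le, ← Real.exp_add,
            neg_add_cancel, Real.exp_zero, ENNReal.ofReal_one, one_mul]
      _ ≤ _ := by gcongr
  have hSt : S ^ (1 / q) ≠ ⊤ := ENNReal.rpow_ne_top_of_nonneg (by positivity) hω.ne
  refine ⟨|B 0 ω| + (S ^ (1 / q)).toReal * Real.exp δ, fun s hs => ?_⟩
  have hexp1 : 1 ≤ Real.exp (-(δ * s)) := Real.one_le_exp (by nlinarith)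
  have hinc : |B s ω - B 0 ω| ≤ (S ^ (1 / q)).toReal * Real.exp δ * Real.exp (-(δ * s)) := by
    rcases hs.eq_or_lt with rfl | hs
    · simp
      positivity
    set n := ⌊-s⌋₊
    have hn : -s ≤ ((n + 1 : ℕ) : ℝ) := by
      push_cast
      exact (Nat.lt_floor_add_one _).le
    have h1 := edist_le_eHolderNorm_mul (r := 0)
      (f := fun u : Set.Icc (0 : ℝ) ((n + 1 : ℕ) : ℝ) => B (-u) ω)
      (x := ⟨-s, by linarith, hn⟩) (y := ⟨0, le_rfl, by positivity⟩)
      (fun h => hs.ne (by simpa using congrArg Subtype.val h))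
    simp only [neg_neg, neg_zero, NNReal.coe_zero, ENNReal.rpow_zero, mul_one] at h1
    have h2 := h1.trans (hSle n)
    rw [edist_dist, Real.dist_eq, ← ENNReal.ofReal_toReal hSt,
      ← ENNReal.ofReal_mul ENNReal.toReal_nonneg,
      ENNReal.ofReal_le_ofReal_iff (by positivity)] at h2
    refine h2.trans ?_
    rw [mul_assoc, ← Real.exp_add]
    gcongr
    have := Nat.floor_le (by linarith : 0 ≤ -s)
    push_cast
    nlinarith
  calc |B s ω| = |B 0 ω + (B s ω - B 0 ω)| := by ring_nf
    _ ≤ |B 0 ω| + |B s ω - B 0 ω| := abs_add_le _ _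
    _ ≤ |B 0 ω| * Real.exp (-(δ * s)) +
        (S ^ (1 / q)).toReal * Real.exp δ * Real.exp (-(δ * s)) :=
        add_le_add (le_mul_of_one_le_right (abs_nonneg _) hexp1) hinc
    _ = _ := by ring

/-! ### Moments of the exponential averages -/

lemma aemeasurable_expMean [SFinite P] (hB : IsTwoSidedFBM H B P) {r : ℝ} (hr : 0 < r) (t : ℝ) :
    AEMeasurable (fun ω => expMean r (fun s => B s ω) t) P := by
  have := isProbabilityMeasure_expMeasure hr
  obtain ⟨B', hm, hB'⟩ := exists_measurable_continuous_modification hB.aemeasurable hB.cont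
  have h1 : Measurable (Function.uncurry fun (ω : Ω) (u : ℝ) => B' t ω - B' (t - u) ω) :=
    (hm.comp (by fun_prop : Measurable fun p : Ω × ℝ => (t, p.1))).sub
      (hm.comp (by fun_prop : Measurable fun p : Ω × ℝ => (t - p.2, p.1)))
  have h2 := h1.stronglyMeasurable.integral_prod_right (ν := expMeasure r)
  refine h2.measurable.aemeasurable.congr ?_
  filter_upwards [hB'] with ω hω
  simp only [expMean, hω]

/-- The relaxation bound: the lag `u` is of order `1 / r`, so the increments over it are of order
`r⁻¹ ^ H`. -/
lemma eLpNorm_expMean_le [SFinite P] (hH : 0 < H) (hB : IsTwoSidedFBM H B P) {r q : ℝ} (hr : 0 < r)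
    (hq : 1 ≤ q) (t : ℝ) :
    eLpNorm (fun ω => expMean r (fun s => B s ω) t) (ENNReal.ofReal q) P ≤
      gaussianNorm q * ENNReal.ofReal (Real.Gamma (H * q + 1)) ^ (1 / q) *
        ENNReal.ofReal (r⁻¹ ^ H) := by
  have := isProbabilityMeasure_expMeasure hr
  obtain ⟨B', hm, hB'⟩ := exists_measurable_continuous_modification hB.aemeasurable hB.cont
  have hq0 : 0 < q := by linarith
  have h1 : Measurable (Function.uncurry fun (u : ℝ) (ω : Ω) => B' t ω - B' (t - u) ω) :=
    (hm.comp (by fun_prop : Measurable fun p : ℝ × Ω => (t, p.2))).sub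
      (hm.comp (by fun_prop : Measurable fun p : ℝ × Ω => (t - p.1, p.2)))
  have h2 := eLpNorm_integral_le (P := P) (ν := expMeasure r) hq h1
    (b := fun u => gaussianNorm q * ENNReal.ofReal (|u| ^ H)) (ae_of_all _ fun u => by
      have e : (fun ω => B' t ω - B' (t - u) ω) =ᵐ[P] B t - B (t - u) := by
        filter_upwards [hB'] with ω hω
        simp [hω]
      rw [eLpNorm_congr_ae e, hB.eLpNorm_sub hH, edist_dist, Real.dist_eq, sub_sub_cancel,
        ENNReal.ofReal_rpow_of_nonneg (abs_nonneg _) hH.le])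
  have e : (fun ω => expMean r (fun s => B s ω) t) =ᵐ[P]
      fun ω => ∫ u, (B' t ω - B' (t - u) ω) ∂expMeasure r := by
    filter_upwards [hB'] with ω hω
    simp only [expMean, hω]
  rw [eLpNorm_congr_ae e]
  refine h2.trans_eq ?_
  have hpow : ∀ u : ℝ, (gaussianNorm q * ENNReal.ofReal (|u| ^ H)) ^ q =
      gaussianNorm q ^ q * ENNReal.ofReal (|u| ^ (H * q)) := by
    intro u
    rw [ENNReal.mul_rpow_of_nonneg _ _ hq0.le,
      ENNReal.ofReal_rpow_of_nonneg (by positivity) hq0.le, ← Real.rpow_mul (abs_nonneg _)]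
  simp_rw [hpow]
  have hG : 0 ≤ Real.Gamma (H * q + 1) := (Real.Gamma_pos_of_pos (by positivity)).le
  rw [lintegral_const_mul' _ _ (ENNReal.rpow_ne_top_of_nonneg hq0.le (gaussianNorm_ne_top q)),
    lintegral_rpow_expMeasure hr (by positivity), ENNReal.ofReal_mul hG,
    ENNReal.mul_rpow_of_nonneg _ _ (by positivity), ENNReal.mul_rpow_of_nonneg _ _ (by positivity),
    ← ENNReal.rpow_mul, mul_one_div_cancel hq0.ne', ENNReal.rpow_one, Real.rpow_mul (by positivity),
    ← ENNReal.ofReal_rpow_of_nonneg (by positivity) hq0.le, ← ENNReal.rpow_mul,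
    mul_one_div_cancel hq0.ne', ENNReal.rpow_one, mul_assoc]

/-- The regularity of the path is inherited by its exponential averages. -/
lemma eLpNorm_expMean_sub_le [SFinite P] (hH : 0 < H) (hB : IsTwoSidedFBM H B P) {r q : ℝ}
    (hr : 0 < r) (hq : 1 ≤ q) (s t : ℝ) :
    eLpNorm (fun ω => expMean r (fun s => B s ω) t - expMean r (fun s => B s ω) s)
      (ENNReal.ofReal q) P ≤ 2 * gaussianNorm q * edist t s ^ H := by
  have := isProbabilityMeasure_expMeasure hr
  obtain ⟨B', hm, hB'⟩ := exists_measurable_continuous_modification hB.aemeasurable hB.cont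
  have hq0 : 0 < q := by linarith
  have h1 : Measurable (Function.uncurry fun (u : ℝ) (ω : Ω) =>
      (B' t ω - B' s ω) - (B' (t - u) ω - B' (s - u) ω)) :=
    ((hm.comp (by fun_prop : Measurable fun p : ℝ × Ω => (t, p.2))).sub
      (hm.comp (by fun_prop : Measurable fun p : ℝ × Ω => (s, p.2)))).sub
    ((hm.comp (by fun_prop : Measurable fun p : ℝ × Ω => (t - p.1, p.2))).sub
      (hm.comp (by fun_prop : Measurable fun p : ℝ × Ω => (s - p.1, p.2))))
  have hsub : ∀ x y, AEStronglyMeasurable (B x - B y) P := fun x y =>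
    ((hB.aemeasurable x).sub (hB.aemeasurable y)).aestronglyMeasurable
  have h2 := eLpNorm_integral_le (P := P) (ν := expMeasure r) hq h1
    (b := fun _ => 2 * gaussianNorm q * edist t s ^ H) (ae_of_all _ fun u => by
      have e : (fun ω => (B' t ω - B' s ω) - (B' (t - u) ω - B' (s - u) ω)) =ᵐ[P]
          (B t - B s) - (B (t - u) - B (s - u)) := by
        filter_upwards [hB'] with ω hω
        simp [hω]
      rw [eLpNorm_congr_ae e]
      refine (eLpNorm_sub_le (hsub _ _) (hsub _ _)
        (by simpa using ENNReal.ofReal_le_ofReal hq)).trans_eq ?_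
      rw [hB.eLpNorm_sub hH, hB.eLpNorm_sub hH, edist_sub_right]
      ring)
  have e : (fun ω => expMean r (fun s => B s ω) t - expMean r (fun s => B s ω) s) =ᵐ[P]
      fun ω => ∫ u, ((B' t ω - B' s ω) - (B' (t - u) ω - B' (s - u) ω)) ∂expMeasure r := by
    filter_upwards [hB', hB.cont, hB.ae_exists_le_exp hH (half_pos hr)] with ω hω hc ⟨K, hK⟩
    have hi : ∀ x, Integrable (fun u => B x ω - B (x - u) ω) (expMeasure r) := fun x =>
      (integrable_const _).sub (integrable_comp_sub_left_expMeasure hr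
        (k := fun s => B s ω) (integrableOn_Iic_exp_mul (half_lt_self hr) hc hK x))
    simp only [expMean, hω]
    rw [← integral_sub (hi t) (hi s)]
    congr 1
    ext u
    ring
  rw [eLpNorm_congr_ae e]
  refine h2.trans_eq ?_
  rw [lintegral_const, measure_univ, mul_one, ← ENNReal.rpow_mul, mul_one_div_cancel hq0.ne',
    ENNReal.rpow_one]

/-! ### The error process -/

/-- Almost surely, for all times simultaneously, the error is `-σ Y`, up to a constant, where `Y` is
the exponential average of the increments of the path. -/
lemma ae_errorProcess_eq (hH : 0 < H) (hB : IsTwoSidedFBM H B P) (σ : ℝ) {ε : ℝ} (hε : 0 < ε) :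
    ∀ᵐ ω ∂P, Continuous (fun t => errorProcess H σ B ε t ω) ∧ ∀ t, errorProcess H σ B ε t ω =
      -σ * expMean ε⁻¹ (fun s => B s ω) t
        + σ * (expMean ε⁻¹ (fun s => B s ω) 0 - B 0 ω) := by
  have hr : 0 < ε⁻¹ := inv_pos.2 hε
  filter_upwards [hB.cont, hB.ae_exists_le_exp hH (half_pos hr)] with ω hc ⟨K, hK⟩
  obtain ⟨hYc, hYi⟩ := continuous_expMean_and_integral hr (half_lt_self hr) hc hK
  have hfOU : ∀ t, fOU H σ B ε t ω = σ / ε ^ H * expMean ε⁻¹ (fun s => B s ω) t := fun t => by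
    rw [fOU, improperRSIntegral_exp_eq_expMean hε (half_lt_self hr) hc hK]
  have herr : ∀ t, errorProcess H σ B ε t ω = -σ * expMean ε⁻¹ (fun s => B s ω) t
        + σ * (expMean ε⁻¹ (fun s => B s ω) 0 - B 0 ω) := by
    intro t
    have h1 := hYi t
    simp only [errorProcess, slowProcess, hfOU]
    rw [intervalIntegral.integral_const_mul, Real.rpow_sub_one hε.ne']
    have hpos : 0 < ε ^ H := Real.rpow_pos_of_pos hε H
    have e : ε ^ H / ε * (σ / ε ^ H * ∫ s in (0 : ℝ)..t, expMean ε⁻¹ (fun s => B s ω) s) =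
        σ * (ε⁻¹ * ∫ s in (0 : ℝ)..t, expMean ε⁻¹ (fun s => B s ω) s) := by
      field_simp
    rw [e, h1]
    ring
  refine ⟨?_, herr⟩
  simp_rw [herr]
  fun_prop

lemma aemeasurable_errorProcess [SFinite P] (hH : 0 < H) (hB : IsTwoSidedFBM H B P) (σ : ℝ) {ε : ℝ}
    (hε : 0 < ε) (t : ℝ) : AEMeasurable (errorProcess H σ B ε t) P := by
  have hY := fun t => hB.aemeasurable_expMean (inv_pos.2 hε) t
  refine (((hY t).const_mul (-σ)).add (((hY 0).sub (hB.aemeasurable 0)).const_mul σ)).congr ?_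
  filter_upwards [hB.ae_errorProcess_eq hH σ hε] with ω hω using (hω.2 t).symm

/-- The increments of the error are bounded both by the relaxation scale `ε` and by the
increment in time. -/
lemma exists_eLpNorm_errorProcess_sub_le [SFinite P] (hH : 0 < H) (hB : IsTwoSidedFBM H B P)
    (σ : ℝ) {q : ℝ} (hq : 1 ≤ q) :
    ∃ C : ℝ≥0, ∀ ε > 0, ∀ s t,
      eLpNorm (fun ω => errorProcess H σ B ε t ω - errorProcess H σ B ε s ω)
        (ENNReal.ofReal q) P ≤ C * min (ENNReal.ofReal ε) (edist t s) ^ H := by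
  set M := gaussianNorm q * ENNReal.ofReal (Real.Gamma (H * q + 1)) ^ (1 / q) with hM
  have hMt : M ≠ ⊤ := ENNReal.mul_ne_top (gaussianNorm_ne_top q)
    (ENNReal.rpow_ne_top_of_nonneg (by positivity) ENNReal.ofReal_ne_top)
  set D := ‖σ‖ₑ * (2 * (M + gaussianNorm q)) with hD
  have hDt : D ≠ ⊤ := ENNReal.mul_ne_top enorm_ne_top
    (ENNReal.mul_ne_top ENNReal.ofNat_ne_top (ENNReal.add_ne_top.2 ⟨hMt, gaussianNorm_ne_top q⟩))
  refine ⟨D.toNNReal, fun ε hε s t => ?_⟩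
  rw [ENNReal.coe_toNNReal hDt]
  set Y : ℝ → Ω → ℝ := fun t ω => expMean ε⁻¹ (fun s => B s ω) t
  have hr : 0 < ε⁻¹ := inv_pos.2 hε
  have e : (fun ω => errorProcess H σ B ε t ω - errorProcess H σ B ε s ω) =ᵐ[P]
      (-σ) • fun ω => Y t ω - Y s ω := by
    filter_upwards [hB.ae_errorProcess_eq hH σ hε] with ω hω
    rw [hω.2, hω.2, Pi.smul_apply, smul_eq_mul]
    ring
  have hYm : ∀ t, AEStronglyMeasurable (Y t) P := fun t =>
    (hB.aemeasurable_expMean hr t).aestronglyMeasurable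
  have hYt : ∀ t, eLpNorm (Y t) (ENNReal.ofReal q) P ≤ M * ENNReal.ofReal ε ^ H := fun t => by
    have := hB.eLpNorm_expMean_le hH hr hq t
    rwa [inv_inv, ← ENNReal.ofReal_rpow_of_pos hε] at this
  have hb1 : eLpNorm (fun ω => Y t ω - Y s ω) (ENNReal.ofReal q) P ≤
      2 * M * ENNReal.ofReal ε ^ H := by
    refine (eLpNorm_sub_le (hYm t) (hYm s) (by simpa using ENNReal.ofReal_le_ofReal hq)).trans ?_
    rw [mul_assoc, two_mul]
    exact add_le_add (hYt t) (hYt s)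
  have hb2 := hB.eLpNorm_expMean_sub_le hH hr hq s t
  rw [eLpNorm_congr_ae e, eLpNorm_const_smul, enorm_neg, hD, mul_assoc]
  gcongr
  rcases le_total (ENNReal.ofReal ε) (edist t s) with h | h
  · rw [min_eq_left h]
    refine hb1.trans ?_
    gcongr
    exact le_self_add
  · rw [min_eq_right h]
    refine hb2.trans ?_
    gcongr
    exact le_add_self

end IsTwoSidedFBM

lemma min_rpow_le {x y : ℝ≥0∞} {γ H : ℝ} (hγ : 0 ≤ γ) (hγH : γ ≤ H) :
    min x y ^ H ≤ x ^ (H - γ) * y ^ γ := by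
  calc min x y ^ H = min x y ^ (H - γ) * min x y ^ γ := by
        rw [← ENNReal.rpow_add_of_nonneg _ _ (sub_nonneg.2 hγH) hγ, sub_add_cancel]
    _ ≤ _ := by
        gcongr
        · exact min_le_left _ _
        · exact min_le_right _ _

lemma holderSeminorm_zero_right (r : ℝ≥0) (θ : ℝ → ℝ) : holderSeminorm r 0 θ = 0 := by
  refine le_antisymm (eHolderNorm_le_of_forall_edist_le fun x y => ?_) zero_le
  have hx := le_antisymm x.2.2 x.2.1
  have hy := le_antisymm y.2.2 y.2.1
  simp [hx, hy]

lemma IsTwoSidedFBM.aemeasurable_holderSeminorm_errorProcess [SFinite P] (hH : 0 < H)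
    (hB : IsTwoSidedFBM H B P) (σ : ℝ) {ε : ℝ} (hε : 0 < ε) (r : ℝ≥0) {t : ℝ} (ht : 0 ≤ t) :
    AEMeasurable (fun ω => holderSeminorm r t (fun u => errorProcess H σ B ε u ω)) P := by
  refine aemeasurable_holderSeminorm r ht (fun u => hB.aemeasurable_errorProcess hH σ hε u) ?_
  filter_upwards [hB.ae_errorProcess_eq hH σ hε] with ω hω using hω.1.continuousOn

lemma IsTwoSidedFBM.exists_eLpNorm_holderSeminorm_errorProcess_le [IsProbabilityMeasure P]
    (hH : 0 < H) (hB : IsTwoSidedFBM H B P) (σ : ℝ) {p : ℝ} (hp : 1 ≤ p) {γ' : ℝ≥0} {γ : ℝ}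
    (hγ' : γ' < γ) (hγ : γ < H) :
    ∃ C : ℝ≥0, ∀ ε > 0, ∀ t ≥ 0,
      eLpNorm (fun ω => holderSeminorm γ' t (fun u => errorProcess H σ B ε u ω))
        (ENNReal.ofReal p) P ≤ ENNReal.ofReal (C * t ^ (γ - γ') * ε ^ (H - γ)) := by
  have hγ0 : 0 < γ := γ'.coe_nonneg.trans_lt hγ'
  have hd : 0 < γ - γ' := sub_pos.2 hγ'
  -- an exponent large enough for the continuity theorem to lose less than `γ - γ'`
  set q := max p (2 / (γ - γ'))
  have hpq : p ≤ q := le_max_left _ _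
  have hq0 : 0 < q := by linarith
  have hqγ : γ' + 1 / q < γ := by
    have h1 : 1 / q ≤ 1 / (2 / (γ - γ')) :=
      one_div_le_one_div_of_le (by positivity) (le_max_right _ _)
    rw [one_div_div] at h1
    linarith
  obtain ⟨C, hC⟩ := hB.exists_eLpNorm_errorProcess_sub_le hH σ (hp.trans hpq)
  obtain ⟨A, hA⟩ := exists_eLpNorm_holderSeminorm_le P γ' hq0 hqγ
  refine ⟨A * C, fun ε hε t ht => ?_⟩
  rcases ht.eq_or_lt with rfl | ht0
  · simp [holderSeminorm_zero_right]
  have hcont : ∀ᵐ ω ∂P, ContinuousOn (fun u => errorProcess H σ B ε u ω) (Set.Icc 0 t) := by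
    filter_upwards [hB.ae_errorProcess_eq hH σ hε] with ω hω using hω.1.continuousOn
  have hbound := hA (errorProcess H σ B ε) (C * ENNReal.ofReal ε ^ (H - γ)) t ht0
    (fun u => hB.aemeasurable_errorProcess hH σ hε u) hcont (fun u _ v _ => by
      refine (hC ε hε v u).trans ?_
      rw [mul_assoc]
      gcongr
      exact min_rpow_le hγ0.le hγ.le)
  refine (eLpNorm_le_eLpNorm_of_exponent_le (ENNReal.ofReal_le_ofReal hpq)
    (hB.aemeasurable_holderSeminorm_errorProcess hH σ hε γ' ht).aestronglyMeasurable).trans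
    (hbound.trans_eq ?_)
  rw [ENNReal.ofReal_rpow_of_pos hε, ENNReal.ofReal_mul (by positivity),
    ENNReal.ofReal_mul (by positivity), NNReal.coe_mul, ENNReal.ofReal_mul A.coe_nonneg,
    ENNReal.ofReal_coe_nnreal, ENNReal.ofReal_coe_nnreal]
  ring

end FOU

end

theorem mainTheorem4 {Ω : Type*} [MeasurableSpace Ω] (P : Measure Ω) [IsProbabilityMeasure P]
    (H : ℝ) (hH : H ∈ Set.Ioo (0 : ℝ) 1)
    (B : ℝ → Ω → ℝ) (hB : FOU.IsTwoSidedFBM H B P)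
    (σ : ℝ) (hσ : HasLaw (FOU.fOU H σ B 1 0) (gaussianReal 0 1) P)
    (p : ℝ) (hp : 1 < p) (T : ℝ) (hT : 0 < T) :
    (∃ C : ℝ, ∀ ε > 0, ∀ s ∈ Set.Icc 0 T, ∀ t ∈ Set.Icc 0 T,
      MemLp (fun ω => (FOU.slowProcess H σ B ε t ω - FOU.slowProcess H σ B ε s ω)
          - σ * (B t ω - B s ω)) (ENNReal.ofReal p) P ∧
      eLpNorm (fun ω => (FOU.slowProcess H σ B ε t ω - FOU.slowProcess H σ B ε s ω)
          - σ * (B t ω - B s ω)) (ENNReal.ofReal p) P ≤ ENNReal.ofReal (C * ε ^ H)) ∧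
    (∀ (γ' : ℝ≥0) (γ : ℝ), (γ' : ℝ) < γ → γ < H →
      (∃ C : ℝ, ∀ ε > 0, ∀ t ∈ Set.Icc 0 T,
        AEMeasurable (fun ω => FOU.holderSeminorm γ' t
          (fun u => FOU.errorProcess H σ B ε u ω)) P ∧
        eLpNorm (fun ω => FOU.holderSeminorm γ' t
          (fun u => FOU.errorProcess H σ B ε u ω)) (ENNReal.ofReal p) P ≤
          ENNReal.ofReal (C * t ^ (γ - γ') * ε ^ (H - γ))) ∧
      (∀ t₀ ∈ Set.Ioc 0 T, ∃ C : ℝ, ∀ ε > 0, ∀ t ∈ Set.Icc t₀ T,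
        eLpNorm (fun ω => FOU.holderSeminorm γ' t
          (fun u => FOU.errorProcess H σ B ε u ω)) (ENNReal.ofReal p) P ≤
          ENNReal.ofReal (C * t ^ γ * ε ^ (H - γ)))) := by
  have hH0 := hH.1
  refine ⟨?_, fun γ' γ hγ' hγ => ?_⟩
  · obtain ⟨C, hC⟩ := hB.exists_eLpNorm_errorProcess_sub_le hH0 σ hp.le
    refine ⟨C, fun ε hε s _ t _ => ?_⟩
    have e : (fun ω => (FOU.slowProcess H σ B ε t ω - FOU.slowProcess H σ B ε s ω)
        - σ * (B t ω - B s ω)) =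
        fun ω => FOU.errorProcess H σ B ε t ω - FOU.errorProcess H σ B ε s ω := by
      ext ω
      simp only [FOU.errorProcess]
      ring
    rw [e]
    have hle : eLpNorm (fun ω => FOU.errorProcess H σ B ε t ω - FOU.errorProcess H σ B ε s ω)
        (ENNReal.ofReal p) P ≤ ENNReal.ofReal (C * ε ^ H) := by
      rw [ENNReal.ofReal_mul C.coe_nonneg, ENNReal.ofReal_coe_nnreal,
        ← ENNReal.ofReal_rpow_of_pos hε]
      refine (hC ε hε s t).trans ?_
      gcongr
      exact min_le_left _ _
    exact ⟨⟨((hB.aemeasurable_errorProcess hH0 σ hε t).sub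
      (hB.aemeasurable_errorProcess hH0 σ hε s)).aestronglyMeasurable,
      hle.trans_lt ENNReal.ofReal_lt_top⟩, hle⟩
  · obtain ⟨C, hC⟩ :=
      hB.exists_eLpNorm_holderSeminorm_errorProcess_le hH0 σ hp.le hγ' hγ
    refine ⟨⟨C, fun ε hε t ht => ⟨hB.aemeasurable_holderSeminorm_errorProcess hH0 σ hε γ' ht.1,
      hC ε hε t ht.1⟩⟩, fun t₀ ht₀ => ⟨C * t₀ ^ (-(γ' : ℝ)), fun ε hε t ht => ?_⟩⟩
    have ht0 : 0 < t := ht₀.1.trans_le ht.1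
    refine (hC ε hε t ht0.le).trans (ENNReal.ofReal_le_ofReal ?_)
    have h1 : t ^ (-(γ' : ℝ)) ≤ t₀ ^ (-(γ' : ℝ)) :=
      Real.rpow_le_rpow_of_nonpos ht₀.1 ht.1 (neg_nonpos.2 γ'.coe_nonneg)
    rw [sub_eq_add_neg γ, Real.rpow_add ht0, mul_comm (t ^ γ), ← mul_assoc]
    gcongr
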